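/- Let $k\ge 1$ be an integer and consider the normal means model: given a prior $\pi$ (a probability measure on $\mathbb{R}$), $(\theta_j,X_j)_{j\ge1}$ are i.i.d. pairs with $\theta_j\sim\pi$ and $X_j\mid\theta_j\sim\mathcal N(\theta_j,1)$. Let $\mathsf{mmse}_k(\pi)=\inf_{t}\mathbb{E}_\pi[(t(X_1)-\theta_1^k)^2]$, the infimum being over measurable $t:\mathbb{R}\to\mathbb{R}$, and for a measurable estimator $\hat T:\mathbb{R}^n\to\mathbb{R}^n$ let $$\mathsf{TotRegret}_{\pi,k,n}(\hat T)=\mathbb{E}_\pi\Big[\sum_{j=1}^n\big(\hat T_j(X_1,\dots,X_n)-\theta_j^k\big)^2\Big]-n\,\mathsf{mmse}_k(\pi)\in(-\infty,\infty],$$ defined whenever $\mathsf{mmse}_k(\pi)<\infty$. For $h>0$ let $\mathcal P([-h,h])$ be the set of probability measures supported on $[-h,h]$, and for $s>0$ let $\mathsf{SubG}(s)=\{\pi:\ \pi[|\theta|\ge t]\le 2e^{-t^2/(2s)}\ \text{for all } t>0\}$. 1. There is $n_0=n_0(k)$ such that for every $h>0$ there is a constant $c_1=c_1(h,k)>0$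 such that for all $n\ge n_0$, $$\inf_{\hat T}\ \sup_{\pi\in\mathcal P([-h,h])}\mathsf{TotRegret}_{\pi,k,n}(\hat T)\ \ge\ c_1\left(\frac{\log n}{\log\log n}\right)^{k+1}.$$ 2. There is $n_0=n_0(k)$ such that for every $s>0$ there is a constant $c_2=c_2(s,k)>0$ such that for all $n\ge n_0$, $$\inf_{\hat T}\ \sup_{\pi\in\mathsf{SubG}(s)}\mathsf{TotRegret}_{\pi,k,n}(\hat T)\ \ge\ c_2\,(\log n)^{k+1}.$$ Here the infima are over all measurable estimators $\hat T:\mathbb{R}^n\to\mathbb{R}^n$. -/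

import Mathlib

open MeasureTheory ProbabilityTheory
open scoped ENNReal

/-- The normal means model: the Markov kernel `θ ↦ N(θ, 1)`. -/
noncomputable def normalMeans : Kernel ℝ ℝ where
  toFun θ := gaussianReal θ 1
  measurable' := by
    refine Measure.measurable_of_measurable_coe _ fun s hs => ?_
    have h : ∀ θ : ℝ, gaussianReal θ 1 s
        = gaussianReal 0 1 (Prod.mk θ ⁻¹' {p : ℝ × ℝ | p.1 + p.2 ∈ s}) := by
      intro θ
      have h1 : gaussianReal θ 1 = (gaussianReal 0 1).map (θ + ·) := by
        rw [gaussianReal_map_const_add, zero_add]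
      rw [h1, Measure.map_apply (measurable_const_add θ) hs]
      rfl
    simp only [h]
    exact measurable_measure_prodMk_left ((measurable_fst.add measurable_snd) hs)

instance : IsMarkovKernel normalMeans :=
  ⟨fun θ => inferInstanceAs (IsProbabilityMeasure (gaussianReal θ 1))⟩

namespace EmpiricalBayes

/-- The joint law of `(θ, X)` with `θ ∼ π` and `X ∣ θ ∼ P θ`. -/
noncomputable def jointLaw (P : Kernel ℝ ℝ) (π : Measure ℝ) : Measure (ℝ × ℝ) :=
  π.compProd P

/-- The joint law of `n` i.i.d. pairs `(θ_j, X_j)`, `θ_j ∼ π`, `X_j ∣ θ_j ∼ P θ_j`. -/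
noncomputable def sampleLaw (P : Kernel ℝ ℝ) (n : ℕ) (π : Measure ℝ) :
    Measure (Fin n → ℝ × ℝ) :=
  Measure.pi fun _ => jointLaw P π

/-- `mmse_ℓ(π)`: the least mean squared error `E[(t(X) - ℓ(θ))²]` over all
measurable `t : ℝ → ℝ`. -/
noncomputable def mmse (P : Kernel ℝ ℝ) (ℓ : ℝ → ℝ) (π : Measure ℝ) : ℝ≥0∞ :=
  ⨅ (t : ℝ → ℝ) (_ : Measurable t),
    ∫⁻ p, ENNReal.ofReal ((t p.2 - ℓ p.1) ^ 2) ∂(jointLaw P π)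

/-- The total squared error `E[∑_j (T_j(X_1, …, X_n) - ℓ(θ_j))²]`; it may be infinite. -/
noncomputable def totalRisk (P : Kernel ℝ ℝ) (ℓ : ℝ → ℝ) (n : ℕ) (π : Measure ℝ)
    (T : (Fin n → ℝ) → (Fin n → ℝ)) : ℝ≥0∞ :=
  ∫⁻ ω, ENNReal.ofReal (∑ j, (T (fun i => (ω i).2) j - ℓ (ω j).1) ^ 2) ∂(sampleLaw P n π)

/-- The total regret of the estimator `T` at the prior `π`. It takes values in the extended
reals, since the risk of `T` may be infinite. -/
noncomputable def totRegret (P : Kernel ℝ ℝ) (ℓ : ℝ → ℝ) (n : ℕ) (π : Measure ℝ)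
    (T : (Fin n → ℝ) → (Fin n → ℝ)) : EReal :=
  (totalRisk P ℓ n π T : EReal) - ((n * mmse P ℓ π : ℝ≥0∞) : EReal)

/-- The minimax total regret over a class `G` of priors; the infimum is over all measurable
estimators. -/
noncomputable def minimaxTotRegret (P : Kernel ℝ ℝ) (ℓ : ℝ → ℝ) (n : ℕ)
    (G : Set (Measure ℝ)) : EReal :=
  ⨅ (T : (Fin n → ℝ) → (Fin n → ℝ)) (_ : Measurable T), ⨆ π ∈ G, totRegret P ℓ n π T

/-- Probability measures on `ℝ` supported on `[-h, h]`. -/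
def boundedPriors (h : ℝ) : Set (Measure ℝ) :=
  {π | IsProbabilityMeasure π ∧ π (Set.Icc (-h) h) = 1}

/-- The class `SubG(s)` of subgaussian probability measures on `ℝ`. -/
def SubG (s : ℝ) : Set (Measure ℝ) :=
  {π | IsProbabilityMeasure π ∧
    ∀ t : ℝ, 0 < t → π.real {θ | t ≤ |θ|} ≤ 2 * Real.exp (-t ^ 2 / (2 * s))}

end EmpiricalBayes

/-! Fix a cube of `2 ^ m` priors, all close to the point mass at zero. The risk of any estimator
exceeds the oracle risk by the expected squared distance, for each coordinate, from the estimator to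
the posterior moment of θ^k as a function of that coordinate's observation
(`oracle_add_le_totalRisk`). Since the marginal density relative to N(0,1) is at least 1/2, this
distance may be measured under N(0,1). The problem becomes that of estimating a function from the
other observations, and Assouad's lemma (`assouad`) applies once neighbouring priors are hard to
distinguish and the posterior moments are separated by a multiple of the Hamming distance.

Both conditions are read off from moments. Expanding `exp (θ θ')` gives the squared L²(N(0,1)) norm
of a mixture of likelihood ratios with signed weights as the sum over j of (j-th moment)² / j!. A
direction whose only sizeable moment is δ √(d!) in order d thus has norm about δ. Near the point
mass the posterior moment is, up to second order, the numerator of Bayes' formula, which is linear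
in the prior. Multiplying the weights by θ^k shifts the moments by k, so this direction contributes
δ² d! / (d - k)! there, at least δ² m^k when d ≥ m + k. With m directions and δ² of order 1/n, the
regret is of order n · m · δ² m^k, that is m^(k+1).

The directions are signed measures on 6m + 1 equispaced nodes in [0, R], with weights the
coefficients of Lagrange basis polynomials (`sum_momentWeight_mul_pow`, `abs_momentWeight_le`).
Moments beyond order 6m do not vanish, but j! dominates them if R² ≤ m / 2^20
(`sum_exp_momentWeight_le`). The weights have size at most about δ √(d!) R^(-d) times an exponential
in m; they must fit into a small mass ε away from zero, with the linearisation error, of order ε⁴,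
below δ². This limits m: with R bounded, √(d!) costs exp(O(m log m)) and m can be of order log n /
log log n; with R² of order m the cost is exp(O(m)), so m can be of order log n, and ε is small
enough for the priors to be subgaussian. -/

/-! ### Densities of product measures. -/

/-- The integral of a product of functions of separate coordinates against a power of `μ`. -/
theorem lintegral_pi_prod {X : Type*} [MeasurableSpace X] (μ : Measure X) [SigmaFinite μ] :
    ∀ (n : ℕ) (f : Fin n → X → ℝ≥0∞), (∀ i, Measurable (f i)) →
      ∫⁻ x, ∏ i, f i (x i) ∂(Measure.pi fun _ : Fin n => μ) = ∏ i, ∫⁻ x, f i x ∂μ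
  | 0, f, _ => by simp
  | n + 1, f, hf => by
    have hm := (measurePreserving_piFinSuccAbove (fun _ : Fin (n + 1) => μ) 0).symm
    rw [← hm.lintegral_comp_emb (MeasurableEquiv.measurableEmbedding _)]
    simp only [MeasurableEquiv.piFinSuccAbove_symm_apply, Fin.prod_univ_succ]
    have h : ∀ z : X × (Fin n → X), f 0 (Fin.insertNthEquiv (fun _ => X) 0 z 0) *
        ∏ i : Fin n, f i.succ (Fin.insertNthEquiv (fun _ => X) 0 z i.succ)
        = f 0 z.1 * ∏ i : Fin n, f i.succ (z.2 i) := by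
      intro z
      simp [Fin.insertNthEquiv]
    simp only [h]
    rw [lintegral_prod_mul (μ := μ) (ν := Measure.pi fun _ : Fin n => μ)
      (f := f 0) (g := fun y => ∏ i : Fin n, f i.succ (y i)) (hf 0).aemeasurable
      (Finset.measurable_prod _ fun i _ => (hf i.succ).comp (measurable_pi_apply i)).aemeasurable,
      lintegral_pi_prod μ n _ fun i => hf i.succ]

/-- A power of a measure with density has the product density. -/
theorem pi_withDensity_eq {X : Type*} [MeasurableSpace X] (μ : Measure X) [SigmaFinite μ] (n : ℕ)
    (f : X → ℝ≥0∞) (hf : Measurable f) [SigmaFinite (μ.withDensity f)] :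
    (Measure.pi fun _ : Fin n => μ.withDensity f)
      = (Measure.pi fun _ : Fin n => μ).withDensity fun x => ∏ i, f (x i) := by
  refine (Measure.pi_eq fun s hs => ?_)
  rw [withDensity_apply _ (MeasurableSet.univ_pi hs),
    ← lintegral_indicator (MeasurableSet.univ_pi hs)]
  have h : ∀ x : Fin n → X, (Set.univ.pi s).indicator (fun x => ∏ i, f (x i)) x
      = ∏ i, (s i).indicator f (x i) := by
    intro x
    by_cases hx : x ∈ Set.univ.pi s
    · rw [Set.indicator_of_mem hx]
      exact Finset.prod_congr rfl fun i _ => (Set.indicator_of_mem (hx i trivial) f).symm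
    · rw [Set.indicator_of_notMem hx]
      simp only [Set.mem_pi, not_forall] at hx
      obtain ⟨i, -, hi⟩ := hx
      exact (Finset.prod_eq_zero (Finset.mem_univ i) (Set.indicator_of_notMem hi f)).symm
  simp only [h]
  rw [lintegral_pi_prod μ n _ fun i => hf.indicator (hs i)]
  exact Finset.prod_congr rfl fun i _ => by
    rw [lintegral_indicator (hs i), withDensity_apply _ (hs i)]

/-! ### Sign patterns and Assouad's lemma. -/

/-- The sign pattern `u` with the `i`-th sign flipped. -/
def flipSign {ι : Type*} [DecidableEq ι] (i : ι) (u : ι → Bool) : ι → Bool :=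
  Function.update u i (!u i)

theorem flipSign_flipSign {ι : Type*} [DecidableEq ι] (i : ι) (u : ι → Bool) :
    flipSign i (flipSign i u) = u := by
  ext j
  by_cases h : j = i
  · subst h; simp [flipSign]
  · simp [flipSign, h]

theorem sum_flipSign {ι : Type*} [DecidableEq ι] [Fintype ι] {M : Type*} [AddCommMonoid M]
    (i : ι) (f : (ι → Bool) → M) : ∑ u, f (flipSign i u) = ∑ u, f u :=
  Fintype.sum_equiv ⟨flipSign i, flipSign i, flipSign_flipSign i, flipSign_flipSign i⟩ _ _
    fun _ => rfl

/-- The number `±1` attached to a sign. -/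
def signVal (b : Bool) : ℝ := if b then 1 else -1

theorem signVal_not (b : Bool) : signVal (!b) = -signVal b := by cases b <;> simp [signVal]

theorem abs_signVal (b : Bool) : |signVal b| = 1 := by cases b <;> simp [signVal]

theorem sq_signVal (b : Bool) : signVal b ^ 2 = 1 := by cases b <;> simp [signVal]

theorem sq_signVal_sub (a b : Bool) :
    (signVal a - signVal b) ^ 2 = 4 * if a ≠ b then 1 else 0 := by
  cases a <;> cases b <;> norm_num [signVal]

/-- Weighted variance as a double sum. -/
theorem weighted_variance {U : Type*} [Fintype U] (w a : U → ℝ) (c : ℝ) :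
    ∑ u, ∑ v, w u * w v * (a u - a v) ^ 2
      = 2 * (∑ u, w u) * (∑ u, w u * (c - a u) ^ 2) - 2 * (∑ u, w u * (c - a u)) ^ 2 := by
  have h : ∀ u v, w u * w v * (a u - a v) ^ 2 =
      w u * (c - a u) ^ 2 * w v + w u * (w v * (c - a v) ^ 2)
        - 2 * (w u * (c - a u) * (w v * (c - a v))) := by
    intro u v; ring
  simp only [h, Finset.sum_sub_distrib, Finset.sum_add_distrib, ← Finset.mul_sum,
    ← Finset.sum_mul]
  ring

/-- The difference of the two sides is (q(1 + c) - p)² / q + p c². The bound is sharp at p = q, c =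
0, and its left side integrates to 3 minus a χ² affinity when p and q are densities. -/
theorem two_point_bound {p q : ℝ} (hp : 0 < p) (hq : 0 < q) (c : ℝ) :
    3 * p - p ^ 2 / q ≤ p * (1 - c) ^ 2 + q * (1 + c) ^ 2 := by
  have h : p * (1 - c) ^ 2 + q * (1 + c) ^ 2 - (3 * p - p ^ 2 / q)
      = (q * (1 + c) - p) ^ 2 / q + p * c ^ 2 := by
    field_simp; ring
  have : 0 ≤ (q * (1 + c) - p) ^ 2 / q + p * c ^ 2 := by positivity
  linarith

theorem two_point_bound_sign {p q : ℝ} (hp : 0 < p) (hq : 0 < q) (c : ℝ) (b : Bool) :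
    3 * p - p ^ 2 / q ≤ p * (c - signVal b) ^ 2 + q * (c - signVal (!b)) ^ 2 := by
  cases b
  · have := two_point_bound hp hq (-c)
    simp only [signVal]; norm_num; nlinarith
  · have := two_point_bound hp hq c
    simp only [signVal]; norm_num; nlinarith

/-- The Hamming distance of sign patterns, weighted by positive weights, is bounded below by the
pairwise affinities of neighbours. -/
theorem weighted_hamming_bound {ι : Type*} [DecidableEq ι] [Fintype ι]
    (w : (ι → Bool) → ℝ) (hw : ∀ u, 0 < w u) :
    ∑ i, ∑ u, (1 / 8) * (3 * w u - w u ^ 2 / w (flipSign i u)) ≤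
      ∑ u, ∑ v, w u * w v / (2 * ∑ u, w u) * (hammingDist u v : ℝ) := by
  set W := ∑ u, w u with hW
  have hWpos : 0 < W := Finset.sum_pos (fun u _ => hw u) Finset.univ_nonempty
  have hd : ∀ u v : ι → Bool, (hammingDist u v : ℝ) =
      ∑ i, (1 / 4) * (signVal (u i) - signVal (v i)) ^ 2 := by
    intro u v
    simp only [sq_signVal_sub, hammingDist]
    rw [Finset.card_filter]
    push_cast
    exact Finset.sum_congr rfl fun i _ => by ring_nf
  have hswap : ∑ u, ∑ v, w u * w v / (2 * W) * (hammingDist u v : ℝ)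
      = ∑ i, (1 / (8 * W)) * ∑ u, ∑ v, w u * w v * (signVal (u i) - signVal (v i)) ^ 2 := by
    simp only [hd, Finset.mul_sum]
    symm
    rw [Finset.sum_comm]
    refine Finset.sum_congr rfl fun u _ => ?_
    rw [Finset.sum_comm]
    refine Finset.sum_congr rfl fun v _ => Finset.sum_congr rfl fun i _ => ?_
    field_simp; ring
  rw [hswap]
  refine Finset.sum_le_sum fun i _ => ?_
  -- The barycentre of the i-th signs, for which the squared term in `weighted_variance` vanishes.
  set c := (∑ u, w u * signVal (u i)) / W with hc
  have h0 : ∑ u, w u * (c - signVal (u i)) = 0 := by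
    simp only [mul_sub, Finset.sum_sub_distrib, ← Finset.sum_mul]
    rw [hc, ← hW]; field_simp; ring
  rw [weighted_variance w (fun u => signVal (u i)) c, h0, ← hW]
  -- Pairing each pattern with its i-th neighbour reduces the variance to two-point problems.
  have h1 : 2 * ∑ u, w u * (c - signVal (u i)) ^ 2 =
      ∑ u, (w u * (c - signVal (u i)) ^ 2
        + w (flipSign i u) * (c - signVal (!u i)) ^ 2) := by
    rw [Finset.sum_add_distrib, two_mul]
    congr 1
    rw [← sum_flipSign i]
    exact Finset.sum_congr rfl fun u _ => by simp [flipSign]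
  have h2 : ∑ u, (3 * w u - w u ^ 2 / w (flipSign i u)) ≤
      2 * ∑ u, w u * (c - signVal (u i)) ^ 2 := by
    rw [h1]
    exact Finset.sum_le_sum fun u _ => two_point_bound_sign (hw _) (hw _) c _
  rw [← Finset.mul_sum]
  have h3 : 1 / (8 * W) * (2 * W * ∑ u, w u * (c - signVal (u i)) ^ 2 - 2 * 0 ^ 2)
      = (1 / 8) * (2 * ∑ u, w u * (c - signVal (u i)) ^ 2) := by
    field_simp; ring
  rw [h3]
  gcongr

theorem ofReal_sum_sum {U V : Type*} [Fintype U] [Fintype V] (f : U → V → ℝ)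
    (hf : ∀ u v, 0 ≤ f u v) :
    ENNReal.ofReal (∑ u, ∑ v, f u v) = ∑ u, ∑ v, ENNReal.ofReal (f u v) := by
  rw [ENNReal.ofReal_sum_of_nonneg fun u _ => Finset.sum_nonneg fun v _ => hf u v]
  exact Finset.sum_congr rfl fun u _ => ENNReal.ofReal_sum_of_nonneg fun v _ => hf u v

/-- **Assouad's lemma** for the estimation of functions in mean square: `w u` are the densities of
the observation `y`, and `t u` the functions to be estimated. -/
theorem assouad {Y X ι : Type*} [MeasurableSpace Y] [MeasurableSpace X] [DecidableEq ι]
    [Fintype ι] (ν : Measure Y) (γ : Measure X) [SFinite γ]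
    (w : (ι → Bool) → Y → ℝ) (hw : ∀ u y, 0 < w u y) (hwm : ∀ u, Measurable (w u))
    (hw1 : ∀ u, ∫⁻ y, ENNReal.ofReal (w u y) ∂ν = 1)
    (hχ : ∀ i u, ∫⁻ y, ENNReal.ofReal (w u y ^ 2 / w (flipSign i u) y) ∂ν
      ≤ ENNReal.ofReal (3 / 2))
    (t : (ι → Bool) → X → ℝ) (ht : ∀ u, Measurable (t u)) {lam : ℝ} (hlam : 0 ≤ lam)
    (hsep : ∀ u v, ENNReal.ofReal (lam * hammingDist u v)
      ≤ ∫⁻ x, ENNReal.ofReal ((t u x - t v x) ^ 2) ∂γ)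
    (τ : Y → X → ℝ) (hτ : Measurable (Function.uncurry τ)) :
    ENNReal.ofReal (2 ^ Fintype.card ι * (Fintype.card ι * lam * (3 / 16))) ≤
      ∑ u, ∫⁻ y, ENNReal.ofReal (w u y) *
        ∫⁻ x, ENNReal.ofReal ((τ y x - t u x) ^ 2) ∂γ ∂ν := by
  have hτm : ∀ y, Measurable (τ y) := fun y => hτ.comp measurable_prodMk_left
  have hinner : ∀ u, Measurable fun y => ∫⁻ x, ENNReal.ofReal ((τ y x - t u x) ^ 2) ∂γ := by
    intro u
    refine Measurable.lintegral_prod_right' (f := fun z : Y × X =>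
      ENNReal.ofReal ((τ z.1 z.2 - t u z.2) ^ 2)) ?_
    exact ((hτ.sub ((ht u).comp measurable_snd)).pow_const 2).ennreal_ofReal
  have hprod : ∀ u, Measurable fun y => ENNReal.ofReal (w u y) *
      ∫⁻ x, ENNReal.ofReal ((τ y x - t u x) ^ 2) ∂γ := fun u =>
    ((hwm u).ennreal_ofReal).mul (hinner u)
  rw [← lintegral_finsetSum _ fun u _ => hprod u]
  -- The χ² term, negative in `weighted_hamming_bound`, is put beside the risk to stay in `ℝ≥0∞`.
  -- After integration 3/8 is at most the normalised risk plus 1/8 · 3/2 = 3/16.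
  have hpt : ∀ y, ∑ i : ι, ∑ u, ENNReal.ofReal (3 * lam / 8) * ENNReal.ofReal (w u y) ≤
      (∑ u, ENNReal.ofReal (w u y) * ∫⁻ x, ENNReal.ofReal ((τ y x - t u x) ^ 2) ∂γ) +
      ∑ i, ∑ u, ENNReal.ofReal (lam / 8) *
        ENNReal.ofReal (w u y ^ 2 / w (flipSign i u) y) := by
    intro y
    set W := ∑ u, w u y with hW
    have hWpos : 0 < W := Finset.sum_pos (fun u _ => hw u y) Finset.univ_nonempty
    have h1 : ENNReal.ofReal (∑ u, ∑ v, w u y * w v y / (2 * W) * (lam * hammingDist u v)) ≤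
        ∑ u, ENNReal.ofReal (w u y) * ∫⁻ x, ENNReal.ofReal ((τ y x - t u x) ^ 2) ∂γ := by
      have hnn : ∀ u v, 0 ≤ w u y * w v y / (2 * W) := fun u v => by
        have := hw u y; have := hw v y; positivity
      rw [ofReal_sum_sum _ fun u v => mul_nonneg (hnn u v) (by positivity)]
      simp_rw [ENNReal.ofReal_mul (hnn _ _)]
      calc _ ≤ ∑ u, ∑ v, ENNReal.ofReal (w u y * w v y / (2 * W)) *
            ∫⁻ x, ENNReal.ofReal ((t u x - t v x) ^ 2) ∂γ := by
            gcongr with u _ v _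
            exact hsep u v
        _ = ∫⁻ x, ENNReal.ofReal (∑ u, ∑ v, w u y * w v y / (2 * W) *
              (t u x - t v x) ^ 2) ∂γ := by
            have : ∀ x, ENNReal.ofReal (∑ u, ∑ v, w u y * w v y / (2 * W) *
              (t u x - t v x) ^ 2) = ∑ u, ∑ v, ENNReal.ofReal (w u y * w v y / (2 * W)) *
                ENNReal.ofReal ((t u x - t v x) ^ 2) := by
              intro x
              rw [ofReal_sum_sum _ fun u v => mul_nonneg (hnn u v) (sq_nonneg _)]
              simp_rw [ENNReal.ofReal_mul (hnn _ _)]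
            simp only [this]
            have hm : ∀ u v, Measurable fun x => ENNReal.ofReal (w u y * w v y / (2 * W)) *
                ENNReal.ofReal ((t u x - t v x) ^ 2) := fun u v =>
              ((((ht u).sub (ht v)).pow_const 2).ennreal_ofReal).const_mul _
            rw [lintegral_finsetSum _ fun u _ => Finset.measurable_sum _ fun v _ => hm u v]
            refine Finset.sum_congr rfl fun u _ => ?_
            rw [lintegral_finsetSum _ fun v _ => hm u v]
            exact Finset.sum_congr rfl fun v _ =>
              (lintegral_const_mul _ (((ht u).sub (ht v)).pow_const 2).ennreal_ofReal).symm
        -- The spread about any centre τ dominates the variance, so τ need not be projected to the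
        -- cube.
        _ ≤ ∫⁻ x, ENNReal.ofReal (∑ u, w u y * (τ y x - t u x) ^ 2) ∂γ := by
            refine lintegral_mono fun x => ENNReal.ofReal_le_ofReal ?_
            have := weighted_variance (fun u => w u y) (fun u => t u x) (τ y x)
            have h2 : ∑ u, ∑ v, w u y * w v y / (2 * W) * (t u x - t v x) ^ 2
                = (∑ u, ∑ v, w u y * w v y * (t u x - t v x) ^ 2) / (2 * W) := by
              simp only [Finset.sum_div]
              exact Finset.sum_congr rfl fun u _ => Finset.sum_congr rfl fun v _ => by ring
            rw [h2, this, ← hW, div_le_iff₀ (by positivity)]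
            nlinarith [sq_nonneg (∑ u, w u y * (τ y x - t u x))]
        _ = _ := by
            have : ∀ x, ENNReal.ofReal (∑ u, w u y * (τ y x - t u x) ^ 2) =
                ∑ u, ENNReal.ofReal (w u y) * ENNReal.ofReal ((τ y x - t u x) ^ 2) := by
              intro x
              rw [ENNReal.ofReal_sum_of_nonneg fun u _ => mul_nonneg (hw u y).le (sq_nonneg _)]
              exact Finset.sum_congr rfl fun u _ => ENNReal.ofReal_mul (hw u y).le
            simp only [this]
            have hm : ∀ u, Measurable fun x => ENNReal.ofReal ((τ y x - t u x) ^ 2) := fun u =>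
              (((hτm y).sub (ht u)).pow_const 2).ennreal_ofReal
            rw [lintegral_finsetSum _ fun u _ => (hm u).const_mul _]
            exact Finset.sum_congr rfl fun u _ => lintegral_const_mul _ (hm u)
    refine le_trans ?_ (add_le_add_left h1 _)
    have hq : ∀ i u, 0 ≤ w u y ^ 2 / w (flipSign i u) y := fun i u => by
      have := hw (flipSign i u) y; positivity
    have e1 : ∑ i : ι, ∑ u, ENNReal.ofReal (3 * lam / 8) * ENNReal.ofReal (w u y)
        = ENNReal.ofReal (∑ i : ι, ∑ u, (3 * lam / 8) * w u y) := by
      rw [ofReal_sum_sum _ fun i u => by have := hw u y; positivity]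
      simp_rw [ENNReal.ofReal_mul (by positivity : 0 ≤ 3 * lam / 8)]
    have e2 : ∑ i : ι, ∑ u, ENNReal.ofReal (lam / 8) *
        ENNReal.ofReal (w u y ^ 2 / w (flipSign i u) y)
        = ENNReal.ofReal (∑ i : ι, ∑ u, (lam / 8) * (w u y ^ 2 / w (flipSign i u) y)) := by
      rw [ofReal_sum_sum _ fun i u => mul_nonneg (by positivity) (hq i u)]
      simp_rw [ENNReal.ofReal_mul (by positivity : 0 ≤ lam / 8)]
    rw [e1, e2, ← ENNReal.ofReal_add]
    · refine ENNReal.ofReal_le_ofReal ?_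
      have hb := mul_le_mul_of_nonneg_left
        (weighted_hamming_bound (fun u => w u y) fun u => hw u y) hlam
      simp only [Finset.mul_sum] at hb ⊢
      have e3 : ∑ i : ι, ∑ u, lam * (1 / 8 * (3 * w u y - w u y ^ 2 / w (flipSign i u) y))
          = (∑ i : ι, ∑ u, (3 * lam / 8) * w u y)
            - ∑ i : ι, ∑ u, (lam / 8) * (w u y ^ 2 / w (flipSign i u) y) := by
        simp only [← Finset.sum_sub_distrib]
        exact Finset.sum_congr rfl fun i _ => Finset.sum_congr rfl fun u _ => by ring
      have e4 : ∑ u, ∑ v, w u y * w v y / (2 * W) * (lam * hammingDist u v)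
          = ∑ u, ∑ v, lam * (w u y * w v y / (∑ u, 2 * w u y) * hammingDist u v) := by
        simp only [← Finset.mul_sum, ← hW]
        simp only [Finset.mul_sum]
        exact Finset.sum_congr rfl fun i _ => Finset.sum_congr rfl fun u _ => by ring
      linarith
    · exact Finset.sum_nonneg fun u _ => Finset.sum_nonneg fun v _ => by
        have := hw u y; have := hw v y; positivity
    · exact Finset.sum_nonneg fun i _ => Finset.sum_nonneg fun u _ =>
        mul_nonneg (by positivity) (hq i u)
  have hmq : ∀ i u, Measurable fun y => ENNReal.ofReal (w u y ^ 2 / w (flipSign i u) y) :=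
    fun i u => (((hwm u).pow_const 2).div (hwm _)).ennreal_ofReal
  have hint := lintegral_mono (μ := ν) hpt
  have hL : ∫⁻ y, ∑ i : ι, ∑ u, ENNReal.ofReal (3 * lam / 8) * ENNReal.ofReal (w u y) ∂ν
      = ENNReal.ofReal (2 ^ Fintype.card ι * (Fintype.card ι * lam * (3 / 8))) := by
    rw [lintegral_finsetSum _ fun i _ => Finset.measurable_sum _ fun u _ =>
      (hwm u).ennreal_ofReal.const_mul _]
    simp_rw [lintegral_finsetSum _ fun u _ => (hwm u).ennreal_ofReal.const_mul _,
      lintegral_const_mul _ (hwm _).ennreal_ofReal, hw1]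
    simp only [mul_one, Finset.sum_const, Finset.card_univ, Fintype.card_fun, Fintype.card_bool,
      nsmul_eq_mul]
    rw [← ENNReal.ofReal_natCast, ← ENNReal.ofReal_natCast, ← ENNReal.ofReal_mul (by positivity),
      ← ENNReal.ofReal_mul (by positivity)]
    congr 1; push_cast; ring
  have hR : ∫⁻ y, ∑ i, ∑ u, ENNReal.ofReal (lam / 8) *
        ENNReal.ofReal (w u y ^ 2 / w (flipSign i u) y) ∂ν
      ≤ ENNReal.ofReal (2 ^ Fintype.card ι * (Fintype.card ι * lam * (3 / 16))) := by
    rw [lintegral_finsetSum _ fun i _ => Finset.measurable_sum _ fun u _ =>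
      (hmq i u).const_mul _]
    simp_rw [lintegral_finsetSum _ fun u _ => (hmq _ u).const_mul _,
      lintegral_const_mul _ (hmq _ _)]
    calc _ ≤ ∑ i : ι, ∑ u : ι → Bool, ENNReal.ofReal (lam / 8) * ENNReal.ofReal (3 / 2) := by
          gcongr with i _ u _
          exact hχ i u
      _ = _ := by
        simp only [Finset.sum_const, Finset.card_univ, Fintype.card_fun, Fintype.card_bool,
          nsmul_eq_mul]
        rw [← ENNReal.ofReal_natCast, ← ENNReal.ofReal_natCast,
          ← ENNReal.ofReal_mul (by positivity), ← ENNReal.ofReal_mul (by positivity),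
          ← ENNReal.ofReal_mul (by positivity)]
        congr 1; push_cast; ring
  rw [lintegral_add_right _ (Finset.measurable_sum _ fun i _ => Finset.measurable_sum _
    fun u _ => (hmq i u).const_mul _), hL] at hint
  have hfin := hint.trans (add_le_add_right hR _)
  have hsplit : ENNReal.ofReal (2 ^ Fintype.card ι * (Fintype.card ι * lam * (3 / 8)))
      = ENNReal.ofReal (2 ^ Fintype.card ι * (Fintype.card ι * lam * (3 / 16)))
        + ENNReal.ofReal (2 ^ Fintype.card ι * (Fintype.card ι * lam * (3 / 16))) := by
    rw [← ENNReal.ofReal_add (by positivity) (by positivity)]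
    congr 1; ring
  rw [hsplit] at hfin
  exact (ENNReal.add_le_add_iff_right ENNReal.ofReal_ne_top).1 hfin

/-! ### Bayes risk for finitely supported priors. -/

/-- The likelihood ratio of `N(θ, 1)` with respect to `N(0, 1)`. -/
noncomputable def lik (x θ : ℝ) : ℝ := Real.exp (x * θ - θ ^ 2 / 2)

theorem lik_pos (x θ : ℝ) : 0 < lik x θ := Real.exp_pos _

theorem lik_zero (x : ℝ) : lik x 0 = 1 := by simp [lik]

theorem measurable_lik (θ : ℝ) : Measurable fun x => lik x θ := by unfold lik; fun_prop

theorem gaussianReal_eq_withDensity_lik (θ : ℝ) :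
    gaussianReal θ 1 = (gaussianReal 0 1).withDensity fun x => ENNReal.ofReal (lik x θ) := by
  rw [gaussianReal_of_var_ne_zero _ one_ne_zero, gaussianReal_of_var_ne_zero _ one_ne_zero,
    ← withDensity_mul _ (measurable_gaussianPDF _ _) (measurable_lik θ).ennreal_ofReal]
  congr 1
  ext x
  simp only [Pi.mul_apply, gaussianPDF]
  rw [← ENNReal.ofReal_mul (gaussianPDFReal_nonneg _ _ _)]
  congr 1
  simp only [gaussianPDFReal, lik, mul_assoc, ← Real.exp_add]
  congr 2
  push_cast
  ring_nf

/-- The prior with atoms `θ a` of masses `p a`. -/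
noncomputable def finPrior {A : Type*} [Fintype A] (p θ : A → ℝ) : Measure ℝ :=
  ∑ a, ENNReal.ofReal (p a) • Measure.dirac (θ a)

/-- The marginal density of the observation with respect to `N(0, 1)`. -/
noncomputable def mixLik {A : Type*} [Fintype A] (p θ : A → ℝ) (x : ℝ) : ℝ :=
  ∑ a, p a * lik x (θ a)

/-- The posterior mean of `θ ^ k`. -/
noncomputable def posteriorMoment {A : Type*} [Fintype A] (k : ℕ) (p θ : A → ℝ) (x : ℝ) : ℝ :=
  mixLik (fun a => p a * θ a ^ k) θ x / mixLik p θ x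

section FinPrior

variable {A : Type*} [Fintype A]

theorem measurable_mixLik (p θ : A → ℝ) : Measurable (mixLik p θ) := by
  unfold mixLik lik; fun_prop

theorem measurable_posteriorMoment (k : ℕ) (p θ : A → ℝ) : Measurable (posteriorMoment k p θ) :=
  (measurable_mixLik _ _).div (measurable_mixLik _ _)

theorem finPrior_isProbabilityMeasure {p : A → ℝ} (θ : A → ℝ) (hp : ∀ a, 0 ≤ p a)
    (hp1 : ∑ a, p a = 1) : IsProbabilityMeasure (finPrior p θ) := by
  constructor
  simp only [finPrior, Measure.coe_finsetSum, Finset.sum_apply, Measure.smul_apply,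
    measure_univ, smul_eq_mul, mul_one]
  rw [← ENNReal.ofReal_sum_of_nonneg fun a _ => hp a, hp1, ENNReal.ofReal_one]

instance finPrior_isFiniteMeasure (p θ : A → ℝ) : IsFiniteMeasure (finPrior p θ) := by
  constructor
  simp [finPrior]

theorem lintegral_jointLaw_finPrior (p θ : A → ℝ) {F : ℝ × ℝ → ℝ≥0∞} (hF : Measurable F) :
    ∫⁻ z, F z ∂(EmpiricalBayes.jointLaw normalMeans (finPrior p θ)) =
      ∑ a, ENNReal.ofReal (p a) *
        ∫⁻ x, ENNReal.ofReal (lik x (θ a)) * F (θ a, x) ∂(gaussianReal 0 1) := by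
  rw [EmpiricalBayes.jointLaw, Measure.lintegral_compProd hF, finPrior,
    lintegral_finsetSum_measure]
  refine Finset.sum_congr rfl fun a _ => ?_
  rw [lintegral_smul_measure, lintegral_dirac, smul_eq_mul]
  congr 1
  change ∫⁻ x, F (θ a, x) ∂(gaussianReal (θ a) 1) = _
  rw [gaussianReal_eq_withDensity_lik,
    lintegral_withDensity_eq_lintegral_mul _ (measurable_lik _).ennreal_ofReal
      (show Measurable fun x => F (θ a, x) from hF.comp measurable_prodMk_left)]
  rfl

theorem lintegral_jointLaw_finPrior_ofReal {p : A → ℝ} (θ : A → ℝ) (hp : ∀ a, 0 ≤ p a)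
    {F : ℝ × ℝ → ℝ} (hF : Measurable F) (hF0 : ∀ z, 0 ≤ F z) :
    ∫⁻ z, ENNReal.ofReal (F z) ∂(EmpiricalBayes.jointLaw normalMeans (finPrior p θ)) =
      ∫⁻ x, ENNReal.ofReal (∑ a, p a * lik x (θ a) * F (θ a, x)) ∂(gaussianReal 0 1) := by
  rw [lintegral_jointLaw_finPrior p θ hF.ennreal_ofReal]
  have hm : ∀ a, Measurable fun x => ENNReal.ofReal (lik x (θ a)) *
      ENNReal.ofReal (F (θ a, x)) := fun a =>
    (measurable_lik _).ennreal_ofReal.mul (hF.comp measurable_prodMk_left).ennreal_ofReal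
  simp_rw [← lintegral_const_mul _ (hm _)]
  rw [← lintegral_finsetSum _ fun a _ => (hm a).const_mul _]
  refine lintegral_congr fun x => ?_
  rw [ENNReal.ofReal_sum_of_nonneg fun a _ =>
    mul_nonneg (mul_nonneg (hp a) (lik_pos _ _).le) (hF0 _)]
  refine Finset.sum_congr rfl fun a _ => ?_
  rw [ENNReal.ofReal_mul (mul_nonneg (hp a) (lik_pos _ _).le), ENNReal.ofReal_mul (hp a), mul_assoc]

theorem map_snd_jointLaw_finPrior {p : A → ℝ} (θ : A → ℝ) (hp : ∀ a, 0 ≤ p a) :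
    (EmpiricalBayes.jointLaw normalMeans (finPrior p θ)).map Prod.snd =
      (gaussianReal 0 1).withDensity fun x => ENNReal.ofReal (mixLik p θ x) := by
  ext s hs
  rw [Measure.map_apply measurable_snd hs, withDensity_apply _ hs,
    ← lintegral_indicator_one (measurable_snd hs), ← lintegral_indicator hs]
  have h1 : ∀ z : ℝ × ℝ, (Prod.snd ⁻¹' s).indicator (1 : ℝ × ℝ → ℝ≥0∞) z =
      ENNReal.ofReal ((Prod.snd ⁻¹' s).indicator (1 : ℝ × ℝ → ℝ) z) := by
    intro z; by_cases h : z ∈ Prod.snd ⁻¹' s <;> simp [h]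
  simp only [h1]
  rw [lintegral_jointLaw_finPrior_ofReal θ hp (measurable_one.indicator (measurable_snd hs))
    fun z => Set.indicator_nonneg (fun _ _ => zero_le_one) _]
  refine lintegral_congr fun x => ?_
  by_cases h : x ∈ s
  · simp [h, mixLik]
  · simp [h]

/-- Bias-variance decomposition: the cross term vanishes because the posterior moment is the mean of
θ^k under the posterior weights. -/
theorem mixLik_mul_sq {p : A → ℝ} (θ : A → ℝ) (k : ℕ) {x : ℝ} (hx : 0 < mixLik p θ x) (c : ℝ) :
    ∑ a, p a * lik x (θ a) * (c - θ a ^ k) ^ 2 =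
      mixLik p θ x * (c - posteriorMoment k p θ x) ^ 2 +
        ∑ a, p a * lik x (θ a) * (posteriorMoment k p θ x - θ a ^ k) ^ 2 := by
  set t := posteriorMoment k p θ x with ht
  have h0 : mixLik p θ x * t = ∑ a, p a * lik x (θ a) * θ a ^ k := by
    rw [ht, posteriorMoment, mul_div_cancel₀ _ hx.ne', mixLik]
    exact Finset.sum_congr rfl fun a _ => by ring
  have h1 : ∀ a, p a * lik x (θ a) * (c - θ a ^ k) ^ 2 =
      p a * lik x (θ a) * (c - t) ^ 2 + p a * lik x (θ a) * (t - θ a ^ k) ^ 2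
        + 2 * (c - t) * (p a * lik x (θ a) * t - p a * lik x (θ a) * θ a ^ k) := by
    intro a; ring
  simp only [h1, Finset.sum_add_distrib, ← Finset.mul_sum, Finset.sum_sub_distrib,
    ← Finset.sum_mul, ← h0]
  simp only [mixLik]
  ring

/-- The mean squared error of an estimator exceeds the minimal one by its distance to the
posterior mean. -/
theorem mmse_add_le {p : A → ℝ} (θ : A → ℝ) (hp : ∀ a, 0 ≤ p a) (k : ℕ)
    (hl : ∀ x, 1 / 2 ≤ mixLik p θ x) {τ : ℝ → ℝ} (hτ : Measurable τ) :
    EmpiricalBayes.mmse normalMeans (fun θ => θ ^ k) (finPrior p θ) +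
      ∫⁻ x, ENNReal.ofReal (1 / 2 * (τ x - posteriorMoment k p θ x) ^ 2) ∂(gaussianReal 0 1) ≤
    ∫⁻ z, ENNReal.ofReal ((τ z.2 - z.1 ^ k) ^ 2)
      ∂(EmpiricalBayes.jointLaw normalMeans (finPrior p θ)) := by
  have ht := measurable_posteriorMoment k p θ
  have hmse : EmpiricalBayes.mmse normalMeans (fun θ => θ ^ k) (finPrior p θ) ≤
      ∫⁻ x, ENNReal.ofReal (∑ a, p a * lik x (θ a) * (posteriorMoment k p θ x - θ a ^ k) ^ 2)
        ∂(gaussianReal 0 1) := by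
    refine (iInf₂_le _ ht).trans ?_
    rw [lintegral_jointLaw_finPrior_ofReal θ hp
      (F := fun z => (posteriorMoment k p θ z.2 - z.1 ^ k) ^ 2) (by fun_prop)
      fun z => sq_nonneg _]
  rw [lintegral_jointLaw_finPrior_ofReal θ hp
      (F := fun z => (τ z.2 - z.1 ^ k) ^ 2) (by fun_prop) fun z => sq_nonneg _]
  refine (add_le_add_left hmse _).trans ?_
  rw [← lintegral_add_right _ (by fun_prop)]
  refine lintegral_mono fun x => ?_
  have hx := hl x
  have hn : 0 ≤ ∑ a, p a * lik x (θ a) * (posteriorMoment k p θ x - θ a ^ k) ^ 2 :=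
    Finset.sum_nonneg fun a _ => mul_nonneg (mul_nonneg (hp a) (lik_pos _ _).le) (sq_nonneg _)
  rw [← ENNReal.ofReal_add hn (by positivity)]
  refine ENNReal.ofReal_le_ofReal ?_
  rw [mixLik_mul_sq θ k (by linarith) (τ x)]
  nlinarith [sq_nonneg (τ x - posteriorMoment k p θ x)]

/-- Finiteness of the oracle risk is what allows it to be moved across the subtraction in `EReal`.
-/
theorem mmse_finPrior_ne_top {p : A → ℝ} (θ : A → ℝ) (k : ℕ) :
    EmpiricalBayes.mmse normalMeans (fun θ => θ ^ k) (finPrior p θ) ≠ ⊤ := by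
  refine ne_top_of_le_ne_top ?_ (iInf₂_le (fun _ => 0) measurable_const)
  rw [lintegral_jointLaw_finPrior p θ (by fun_prop)]
  refine ENNReal.sum_ne_top.2 fun a _ => ENNReal.mul_ne_top ENNReal.ofReal_ne_top ?_
  simp only
  rw [lintegral_mul_const _ (measurable_lik _).ennreal_ofReal]
  refine ENNReal.mul_ne_top ?_ ENNReal.ofReal_ne_top
  have := congrArg (fun μ : Measure ℝ => μ Set.univ) (gaussianReal_eq_withDensity_lik (θ a))
  simp only [measure_univ, withDensity_apply _ MeasurableSet.univ, Measure.restrict_univ] at this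
  rw [← this]
  exact ENNReal.one_ne_top

instance sigmaFinite_withDensity_mixLik (p θ : A → ℝ) : SigmaFinite
    ((gaussianReal 0 1).withDensity fun x => ENNReal.ofReal (mixLik p θ x)) :=
  SigmaFinite.withDensity_ofReal _

/-- The law of the observations for a power of the joint law. -/
theorem lintegral_sampleLaw_snd {p : A → ℝ} (θ : A → ℝ) (hp : ∀ a, 0 ≤ p a) (n : ℕ)
    {F : (Fin n → ℝ) → ℝ≥0∞} (hF : Measurable F) :
    ∫⁻ ω, F (fun i => (ω i).2) ∂(EmpiricalBayes.sampleLaw normalMeans n (finPrior p θ)) =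
      ∫⁻ y, ENNReal.ofReal (∏ i, mixLik p θ (y i)) * F y
        ∂(Measure.pi fun _ : Fin n => gaussianReal 0 1) := by
  have hmap : (EmpiricalBayes.jointLaw normalMeans (finPrior p θ)).map Prod.snd =
      (gaussianReal 0 1).withDensity fun x => ENNReal.ofReal (mixLik p θ x) :=
    map_snd_jointLaw_finPrior θ hp
  have hsig : IsFiniteMeasure (EmpiricalBayes.jointLaw normalMeans (finPrior p θ)) := by
    unfold EmpiricalBayes.jointLaw; infer_instance
  have hmp : MeasurePreserving (fun (ω : Fin n → ℝ × ℝ) i => (ω i).2)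
      (EmpiricalBayes.sampleLaw normalMeans n (finPrior p θ))
      (Measure.pi fun _ : Fin n =>
        (gaussianReal 0 1).withDensity fun x => ENNReal.ofReal (mixLik p θ x)) :=
    measurePreserving_pi _ _ fun _ => ⟨measurable_snd, hmap⟩
  rw [hmp.lintegral_comp hF, pi_withDensity_eq _ _ _ (measurable_mixLik p θ).ennreal_ofReal,
    lintegral_withDensity_eq_lintegral_mul _ (by
      have := measurable_mixLik p θ
      fun_prop) hF]
  refine lintegral_congr fun y => ?_
  have hnn : ∀ i, 0 ≤ mixLik p θ (y i) := fun i =>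
    Finset.sum_nonneg fun a _ => mul_nonneg (hp a) (lik_pos _ _).le
  rw [Pi.mul_apply, ENNReal.ofReal_prod_of_nonneg fun i _ => hnn i]

/-- The total risk exceeds the oracle risk by the expected distance of the estimator to the
posterior mean. -/
theorem oracle_add_le_totalRisk {p : A → ℝ} (θ : A → ℝ) (hp : ∀ a, 0 ≤ p a)
    (hp1 : ∑ a, p a = 1) (k n : ℕ) (hl : ∀ x, 1 / 2 ≤ mixLik p θ x)
    {T : (Fin (n + 1) → ℝ) → (Fin (n + 1) → ℝ)} (hT : Measurable T) :
    ((n + 1 : ℕ) : ℝ≥0∞) * EmpiricalBayes.mmse normalMeans (fun θ => θ ^ k) (finPrior p θ) +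
      ∑ j, ∫⁻ y, ENNReal.ofReal (∏ i, mixLik p θ (y i)) *
        ∫⁻ x, ENNReal.ofReal (1 / 2 * (T (j.insertNth x y) j - posteriorMoment k p θ x) ^ 2)
          ∂(gaussianReal 0 1) ∂(Measure.pi fun _ : Fin n => gaussianReal 0 1) ≤
    EmpiricalBayes.totalRisk normalMeans (fun θ => θ ^ k) (n + 1) (finPrior p θ) T := by
  have := finPrior_isProbabilityMeasure θ hp hp1
  have hprob : IsProbabilityMeasure (EmpiricalBayes.jointLaw normalMeans (finPrior p θ)) := by
    unfold EmpiricalBayes.jointLaw; infer_instance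
  have hprob' : IsProbabilityMeasure
      (EmpiricalBayes.sampleLaw normalMeans n (finPrior p θ)) := by
    unfold EmpiricalBayes.sampleLaw; infer_instance
  have hTj : ∀ j, Measurable fun x => T x j := fun j => (measurable_pi_apply j).comp hT
  have hsplit : EmpiricalBayes.totalRisk normalMeans (fun θ => θ ^ k) (n + 1) (finPrior p θ) T =
      ∑ j, ∫⁻ ω, ENNReal.ofReal ((T (fun i => (ω i).2) j - (ω j).1 ^ k) ^ 2)
        ∂(EmpiricalBayes.sampleLaw normalMeans (n + 1) (finPrior p θ)) := by
    rw [EmpiricalBayes.totalRisk, ← lintegral_finsetSum]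
    · exact lintegral_congr fun ω => ENNReal.ofReal_sum_of_nonneg fun j _ => sq_nonneg _
    · intro j _
      have := hTj j
      fun_prop
  rw [hsplit]
  have hcard : ((n + 1 : ℕ) : ℝ≥0∞) *
      EmpiricalBayes.mmse normalMeans (fun θ => θ ^ k) (finPrior p θ) =
      ∑ _j : Fin (n + 1), EmpiricalBayes.mmse normalMeans (fun θ => θ ^ k) (finPrior p θ) := by
    simp
  rw [hcard, ← Finset.sum_add_distrib]
  -- Given all pairs but the j-th, the j-th component of T is a function of the j-th observation
  -- alone, to which `mmse_add_le` applies.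
  refine Finset.sum_le_sum fun j _ => ?_
  have hm := (measurePreserving_piFinSuccAbove (fun _ : Fin (n + 1) =>
    EmpiricalBayes.jointLaw normalMeans (finPrior p θ)) j).symm
  rw [EmpiricalBayes.sampleLaw,
    ← hm.lintegral_comp_emb (MeasurableEquiv.measurableEmbedding _)]
  have hTi : Measurable fun z : (Fin n → ℝ) × ℝ => T (j.insertNth z.2 z.1) j := by
    refine (hTj j).comp ?_
    have := (MeasurableEquiv.piFinSuccAbove (fun _ : Fin (n + 1) => ℝ) j).symm.measurable
    exact this.comp measurable_swap
  have hint : ∀ z : (ℝ × ℝ) × (Fin n → ℝ × ℝ), ENNReal.ofReal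
      ((T (fun i => ((MeasurableEquiv.piFinSuccAbove (fun _ => ℝ × ℝ) j).symm z i).2) j -
        ((MeasurableEquiv.piFinSuccAbove (fun _ => ℝ × ℝ) j).symm z j).1 ^ k) ^ 2) =
      ENNReal.ofReal ((T (j.insertNth z.1.2 (fun i => (z.2 i).2)) j - z.1.1 ^ k) ^ 2) := by
    intro z
    have : (fun i => ((MeasurableEquiv.piFinSuccAbove (fun _ => ℝ × ℝ) j).symm z i).2) =
        (j.insertNth z.1.2 (fun i => (z.2 i).2) : Fin (n + 1) → ℝ) := by
      ext i
      refine Fin.succAboveCases j ?_ (fun i => ?_) i <;>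
        simp [MeasurableEquiv.piFinSuccAbove_symm_apply, Fin.insertNthEquiv]
    rw [this]
    simp [MeasurableEquiv.piFinSuccAbove_symm_apply, Fin.insertNthEquiv]
  simp only [hint]
  rw [lintegral_prod_symm' _ (by
    have h2 : Measurable fun z : (ℝ × ℝ) × (Fin n → ℝ × ℝ) =>
        T (j.insertNth z.1.2 (fun i => (z.2 i).2)) j :=
      hTi.comp (by fun_prop : Measurable fun z : (ℝ × ℝ) × (Fin n → ℝ × ℝ) =>
        ((fun i => (z.2 i).2 : Fin n → ℝ), z.1.2))
    fun_prop)]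
  have hF : Measurable fun y : Fin n → ℝ => ∫⁻ x, ENNReal.ofReal
      (1 / 2 * (T (j.insertNth x y) j - posteriorMoment k p θ x) ^ 2) ∂(gaussianReal 0 1) := by
    refine Measurable.lintegral_prod_right' (f := fun z : (Fin n → ℝ) × ℝ => ENNReal.ofReal
      (1 / 2 * (T (j.insertNth z.2 z.1) j - posteriorMoment k p θ z.2) ^ 2)) ?_
    have := measurable_posteriorMoment k p θ
    fun_prop
  rw [← lintegral_sampleLaw_snd θ hp n hF]
  calc _ = ∫⁻ ω, (EmpiricalBayes.mmse normalMeans (fun θ => θ ^ k) (finPrior p θ) +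
        ∫⁻ x, ENNReal.ofReal (1 / 2 * (T (j.insertNth x fun i => (ω i).2) j -
          posteriorMoment k p θ x) ^ 2) ∂(gaussianReal 0 1))
        ∂(EmpiricalBayes.sampleLaw normalMeans n (finPrior p θ)) := by
        rw [lintegral_add_left measurable_const, lintegral_const, measure_univ, mul_one]
    _ ≤ _ := by
        refine lintegral_mono fun ω => ?_
        exact mmse_add_le θ hp k hl (τ := fun x => T (j.insertNth x fun i => (ω i).2) j)
          (hTi.comp measurable_prodMk_left)

end FinPrior

/-! ### From a hypercube of priors to the minimax regret. -/

section Mixtures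

variable {A : Type*} [Fintype A]

theorem lintegral_mixLik {p : A → ℝ} (θ : A → ℝ) (hp : ∀ a, 0 ≤ p a) (hp1 : ∑ a, p a = 1) :
    ∫⁻ x, ENNReal.ofReal (mixLik p θ x) ∂(gaussianReal 0 1) = 1 := by
  have := finPrior_isProbabilityMeasure θ hp hp1
  have hprob : IsProbabilityMeasure (EmpiricalBayes.jointLaw normalMeans (finPrior p θ)) := by
    unfold EmpiricalBayes.jointLaw; infer_instance
  have h := congrArg (fun μ : Measure ℝ => μ Set.univ) (map_snd_jointLaw_finPrior θ hp)
  simp only [withDensity_apply _ MeasurableSet.univ, Measure.restrict_univ] at h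
  rw [← h, Measure.map_apply measurable_snd MeasurableSet.univ, Set.preimage_univ, measure_univ]

/-- For densities f and g, f²/g + g = 2f + (f - g)²/g. Integrating, the total masses cancel to leave
1, and g ≥ 1/2 turns the χ² distance into an L² distance. -/
theorem lintegral_sq_mixLik_div_le {p q : A → ℝ} (θ : A → ℝ) (hp : ∀ a, 0 ≤ p a)
    (hp1 : ∑ a, p a = 1) (hq : ∀ a, 0 ≤ q a) (hq1 : ∑ a, q a = 1)
    (hl : ∀ x, 1 / 2 ≤ mixLik q θ x) {η : ℝ} (hη : 0 ≤ η)
    (h : ∫⁻ x, ENNReal.ofReal ((mixLik p θ x - mixLik q θ x) ^ 2) ∂(gaussianReal 0 1)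
      ≤ ENNReal.ofReal η) :
    ∫⁻ x, ENNReal.ofReal (mixLik p θ x ^ 2 / mixLik q θ x) ∂(gaussianReal 0 1)
      ≤ ENNReal.ofReal (1 + 2 * η) := by
  have hmp := measurable_mixLik p θ
  have hmq := measurable_mixLik q θ
  have hpt : ∀ x, ENNReal.ofReal (mixLik p θ x ^ 2 / mixLik q θ x)
      + ENNReal.ofReal (mixLik q θ x) ≤ ENNReal.ofReal 2 * ENNReal.ofReal (mixLik p θ x) +
        ENNReal.ofReal 2 * ENNReal.ofReal ((mixLik p θ x - mixLik q θ x) ^ 2) := by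
    intro x
    have hx := hl x
    have hpx : 0 ≤ mixLik p θ x :=
      Finset.sum_nonneg fun a _ => mul_nonneg (hp a) (lik_pos _ _).le
    rw [← ENNReal.ofReal_mul zero_le_two, ← ENNReal.ofReal_mul zero_le_two,
      ← ENNReal.ofReal_add (by positivity) (by linarith),
      ← ENNReal.ofReal_add (by positivity) (by positivity)]
    refine ENNReal.ofReal_le_ofReal ?_
    have e : mixLik p θ x ^ 2 / mixLik q θ x + mixLik q θ x =
        2 * mixLik p θ x + (mixLik p θ x - mixLik q θ x) ^ 2 / mixLik q θ x := by
      have : mixLik q θ x ≠ 0 := by linarith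
      field_simp; ring
    rw [e, add_le_add_iff_left, div_le_iff₀ (by linarith)]
    nlinarith [sq_nonneg (mixLik p θ x - mixLik q θ x)]
  have hint := lintegral_mono (μ := gaussianReal 0 1) hpt
  rw [lintegral_add_right _ (by fun_prop), lintegral_add_right _ (by fun_prop),
    lintegral_const_mul _ (by fun_prop), lintegral_const_mul _ (by fun_prop),
    lintegral_mixLik θ hp hp1, lintegral_mixLik θ hq hq1] at hint
  have h2 : ENNReal.ofReal 2 * 1 + ENNReal.ofReal 2 *
      ∫⁻ x, ENNReal.ofReal ((mixLik p θ x - mixLik q θ x) ^ 2) ∂(gaussianReal 0 1) ≤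
      ENNReal.ofReal (1 + 2 * η) + 1 := by
    calc _ ≤ ENNReal.ofReal 2 * 1 + ENNReal.ofReal 2 * ENNReal.ofReal η := by gcongr
      _ = _ := by
        rw [mul_one, ← ENNReal.ofReal_mul zero_le_two, ← ENNReal.ofReal_one,
          ← ENNReal.ofReal_add (by positivity) (by positivity),
          ← ENNReal.ofReal_add (by positivity) (by positivity)]
        congr 1; ring
  exact (ENNReal.add_le_add_iff_right ENNReal.one_ne_top).1 (hint.trans h2)

/-- A lower bound on the minimax regret from a hypercube of finitely supported priors. -/
theorem le_minimaxTotRegret_of_hypercube {ι : Type*} [Fintype ι] [DecidableEq ι] (k n : ℕ)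
    (G : Set (Measure ℝ)) (θ : A → ℝ) (p : (ι → Bool) → A → ℝ) (hp : ∀ u a, 0 ≤ p u a)
    (hp1 : ∀ u, ∑ a, p u a = 1) (hl : ∀ u x, 1 / 2 ≤ mixLik (p u) θ x)
    (hG : ∀ u, finPrior (p u) θ ∈ G) {η : ℝ} (hη : 0 ≤ η) (hη1 : (1 + 2 * η) ^ n ≤ 3 / 2)
    (hχ : ∀ i u, ∫⁻ x, ENNReal.ofReal ((mixLik (p u) θ x - mixLik (p (flipSign i u)) θ x) ^ 2)
      ∂(gaussianReal 0 1) ≤ ENNReal.ofReal η)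
    {lam : ℝ} (hlam : 0 ≤ lam)
    (hsep : ∀ u v, ENNReal.ofReal (lam * hammingDist u v) ≤
      ∫⁻ x, ENNReal.ofReal ((posteriorMoment k (p u) θ x - posteriorMoment k (p v) θ x) ^ 2)
        ∂(gaussianReal 0 1)) :
    (((n + 1 : ℕ) * (Fintype.card ι * lam * (3 / 32)) : ℝ) : EReal) ≤
      EmpiricalBayes.minimaxTotRegret normalMeans (fun θ => θ ^ k) (n + 1) G := by
  refine le_iInf₂ fun T hT => ?_
  set ν : Measure (Fin n → ℝ) := Measure.pi fun _ : Fin n => gaussianReal 0 1 with hν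
  set D : (ι → Bool) → Fin (n + 1) → ℝ≥0∞ := fun u j =>
    ∫⁻ y, ENNReal.ofReal (∏ i, mixLik (p u) θ (y i)) *
        ∫⁻ x, ENNReal.ofReal (1 / 2 * (T (j.insertNth x y) j - posteriorMoment k (p u) θ x) ^ 2)
          ∂(gaussianReal 0 1) ∂ν with hD
  have hlpos : ∀ u x, 0 < mixLik (p u) θ x := fun u x => by linarith [hl u x]
  have hjoint : ∀ j : Fin (n + 1),
      Measurable (Function.uncurry fun (y : Fin n → ℝ) (x : ℝ) => T (j.insertNth x y) j) := by
    intro j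
    refine ((measurable_pi_apply j).comp hT).comp ?_
    have := (MeasurableEquiv.piFinSuccAbove (fun _ : Fin (n + 1) => ℝ) j).symm.measurable
    exact this.comp measurable_swap
  have hsum : ∀ j, ENNReal.ofReal (2 ^ Fintype.card ι * (Fintype.card ι * lam * (3 / 32))) ≤
      ∑ u, D u j := by
    intro j
    -- The other n observations y are the data; the dependence of the j-th component of T on its own
    -- observation x is the estimated function.
    have hA := assouad ν (gaussianReal 0 1) (fun u y => ∏ i, mixLik (p u) θ (y i))
      (fun u y => Finset.prod_pos fun i _ => hlpos u _)
      (fun u => Finset.measurable_prod _ fun i _ =>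
        (measurable_mixLik _ _).comp (measurable_pi_apply i))
      (fun u => by
        simp_rw [fun y : Fin n → ℝ => ENNReal.ofReal_prod_of_nonneg (s := Finset.univ)
          (f := fun i => mixLik (p u) θ (y i)) fun i _ => (hlpos u _).le]
        rw [lintegral_pi_prod _ n (fun _ x => ENNReal.ofReal (mixLik (p u) θ x))
          fun _ => (measurable_mixLik _ _).ennreal_ofReal]
        simp [lintegral_mixLik θ (hp u) (hp1 u)])
      (fun i u => by
        have hm1 := measurable_mixLik (p u) θ
        have hm2 := measurable_mixLik (p (flipSign i u)) θ
        simp_rw [← Finset.prod_pow, ← Finset.prod_div_distrib]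
        simp_rw [fun y : Fin n → ℝ => ENNReal.ofReal_prod_of_nonneg (s := Finset.univ)
          (f := fun l => mixLik (p u) θ (y l) ^ 2 / mixLik (p (flipSign i u)) θ (y l))
            fun l _ => by
              have := hlpos (flipSign i u) (y l)
              positivity]
        rw [lintegral_pi_prod _ n (fun _ x => ENNReal.ofReal
          (mixLik (p u) θ x ^ 2 / mixLik (p (flipSign i u)) θ x)) fun _ => by fun_prop]
        rw [Finset.prod_const, Finset.card_univ, Fintype.card_fin]
        calc _ ≤ ENNReal.ofReal (1 + 2 * η) ^ n := by
              gcongr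
              exact lintegral_sq_mixLik_div_le θ (hp u) (hp1 u) (hp _) (hp1 _) (hl _) hη (hχ i u)
          _ = ENNReal.ofReal ((1 + 2 * η) ^ n) := (ENNReal.ofReal_pow (by positivity) n).symm
          _ ≤ _ := ENNReal.ofReal_le_ofReal hη1)
      (fun u => posteriorMoment k (p u) θ) (fun u => measurable_posteriorMoment _ _ _) hlam hsep
      (fun y x => T (j.insertNth x y) j) (hjoint j)
    have hDu : ∀ u, D u j = ENNReal.ofReal (1 / 2) *
        ∫⁻ y, ENNReal.ofReal (∏ i, mixLik (p u) θ (y i)) *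
        ∫⁻ x, ENNReal.ofReal ((T (j.insertNth x y) j - posteriorMoment k (p u) θ x) ^ 2)
          ∂(gaussianReal 0 1) ∂ν := by
      intro u
      simp only [hD]
      have h1 : ∀ y : Fin n → ℝ, Measurable fun x => T (j.insertNth x y) j := fun y =>
        (hjoint j).comp measurable_prodMk_left
      have h2 := measurable_posteriorMoment k (p u) θ
      have h3 : ∀ y : Fin n → ℝ, ∫⁻ x, ENNReal.ofReal (1 / 2 *
          (T (j.insertNth x y) j - posteriorMoment k (p u) θ x) ^ 2) ∂(gaussianReal 0 1) =
          ENNReal.ofReal (1 / 2) * ∫⁻ x, ENNReal.ofReal (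
          (T (j.insertNth x y) j - posteriorMoment k (p u) θ x) ^ 2) ∂(gaussianReal 0 1) := by
        intro y
        simp_rw [ENNReal.ofReal_mul (by norm_num : (0:ℝ) ≤ 1 / 2)]
        have h4 := h1 y
        rw [lintegral_const_mul _ (by fun_prop)]
      simp only [h3]
      simp_rw [mul_left_comm _ (ENNReal.ofReal (1 / 2))]
      rw [lintegral_const_mul']
      exact ENNReal.ofReal_ne_top
    simp only [hDu]
    rw [← Finset.mul_sum]
    calc _ = ENNReal.ofReal (1 / 2) *
          ENNReal.ofReal (2 ^ Fintype.card ι * (Fintype.card ι * lam * (3 / 16))) := by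
          rw [← ENNReal.ofReal_mul (by norm_num)]
          congr 1; ring
      _ ≤ _ := by gcongr
  -- One prior has to serve all coordinates at once, so the average over u is taken after summing
  -- over j.
  have hex : ∃ u, ENNReal.ofReal ((n + 1 : ℕ) * (Fintype.card ι * lam * (3 / 32))) ≤
      ∑ j, D u j := by
    by_contra! hlt
    have h1 : ∑ u, ∑ j, D u j < ∑ _u : ι → Bool,
        ENNReal.ofReal ((n + 1 : ℕ) * (Fintype.card ι * lam * (3 / 32))) := by
      refine ENNReal.sum_lt_sum_of_nonempty Finset.univ_nonempty fun u _ => hlt u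
    rw [Finset.sum_comm] at h1
    have h2 := Finset.sum_le_sum fun j (_ : j ∈ Finset.univ) => hsum j
    refine absurd (h2.trans_lt h1) (not_lt.2 (le_of_eq ?_))
    simp only [Finset.sum_const, Finset.card_univ, Fintype.card_fun, Fintype.card_bool,
      Fintype.card_fin, nsmul_eq_mul]
    rw [← ENNReal.ofReal_natCast, ← ENNReal.ofReal_natCast, ← ENNReal.ofReal_mul (by positivity),
      ← ENNReal.ofReal_mul (by positivity)]
    congr 1; push_cast; ring
  obtain ⟨u, hu⟩ := hex
  refine le_trans ?_ (le_iSup₂ (finPrior (p u) θ) (hG u))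
  have horacle := oracle_add_le_totalRisk θ (hp u) (hp1 u) k n (hl u) hT
  have hfin : ((n + 1 : ℕ) : ℝ≥0∞) *
      EmpiricalBayes.mmse normalMeans (fun θ => θ ^ k) (finPrior (p u) θ) ≠ ⊤ :=
    ENNReal.mul_ne_top (ENNReal.natCast_ne_top _) (mmse_finPrior_ne_top θ k)
  have h3 := (add_le_add_right hu _).trans horacle
  rw [EmpiricalBayes.totRegret]
  rw [EReal.le_sub_iff_add_le (Or.inl (EReal.coe_ennreal_ne_bot _))
    (Or.inl (by simpa only [ne_eq, EReal.coe_ennreal_eq_top_iff] using hfin))]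
  have h4 := EReal.coe_ennreal_le_coe_ennreal_iff.2 h3
  rw [EReal.coe_ennreal_add, EReal.coe_ennreal_ofReal, max_eq_left (by positivity), add_comm] at h4
  exact h4

end Mixtures

/-! ### L² norms of mixtures through moments. -/

section GaussianIntegrals

theorem lik_mul_lik (x θ θ' : ℝ) :
    lik x θ * lik x θ' = Real.exp (-(θ ^ 2 + θ' ^ 2) / 2) * Real.exp ((θ + θ') * x) := by
  rw [lik, lik, ← Real.exp_add, ← Real.exp_add]
  congr 1; ring

theorem integrable_lik_mul_lik (θ θ' : ℝ) :
    Integrable (fun x => lik x θ * lik x θ') (gaussianReal 0 1) := by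
  simp only [lik_mul_lik]
  exact (integrable_exp_mul_gaussianReal (θ + θ')).const_mul _

theorem integral_exp_mul_gaussianReal_zero_one (t : ℝ) :
    ∫ x, Real.exp (t * x) ∂(gaussianReal 0 1) = Real.exp (t ^ 2 / 2) := by
  have h := mgf_gaussianReal (p := gaussianReal 0 1) (X := id) (μ := 0) (v := 1) (by simp) t
  rw [mgf] at h
  simpa using h

theorem integral_lik_mul_lik (θ θ' : ℝ) :
    ∫ x, lik x θ * lik x θ' ∂(gaussianReal 0 1) = Real.exp (θ * θ') := by
  simp only [lik_mul_lik]
  rw [integral_const_mul, integral_exp_mul_gaussianReal_zero_one, ← Real.exp_add]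
  congr 1; ring

variable {A : Type*} [Fintype A]

/-- The square norm of a mixture of likelihood ratios in terms of the moments. -/
theorem hasSum_sq_moment_div_factorial (c θ : A → ℝ) :
    HasSum (fun j : ℕ => (∑ a, c a * θ a ^ j) ^ 2 / (j.factorial : ℝ))
      (∑ a, ∑ b, c a * c b * Real.exp (θ a * θ b)) := by
  have h : ∀ a b, HasSum (fun j : ℕ => c a * c b * ((θ a * θ b) ^ j / (j.factorial : ℝ)))
      (c a * c b * Real.exp (θ a * θ b)) := by
    intro a b
    refine HasSum.mul_left _ ?_
    rw [Real.exp_eq_exp_ℝ]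
    exact NormedSpace.expSeries_div_hasSum_exp _
  have h2 := hasSum_sum (s := Finset.univ) fun a _ =>
    hasSum_sum (s := Finset.univ) fun b _ => h a b
  convert h2 using 2 with j
  rw [sq, Finset.sum_mul_sum, Finset.sum_div]
  refine Finset.sum_congr rfl fun a _ => ?_
  rw [Finset.sum_div]
  exact Finset.sum_congr rfl fun b _ => by rw [mul_pow]; ring

theorem lintegral_sq_mixLik (c θ : A → ℝ) :
    ∫⁻ x, ENNReal.ofReal (mixLik c θ x ^ 2) ∂(gaussianReal 0 1) =
      ENNReal.ofReal (∑ a, ∑ b, c a * c b * Real.exp (θ a * θ b)) := by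
  have hexp : ∀ x, mixLik c θ x ^ 2 =
      ∑ a, ∑ b, c a * c b * (lik x (θ a) * lik x (θ b)) := by
    intro x
    rw [mixLik, sq, Finset.sum_mul_sum]
    exact Finset.sum_congr rfl fun a _ => Finset.sum_congr rfl fun b _ => by ring
  have hi : ∀ a b, Integrable (fun x => c a * c b * (lik x (θ a) * lik x (θ b)))
      (gaussianReal 0 1) := fun a b => (integrable_lik_mul_lik _ _).const_mul _
  have hI : Integrable (fun x => mixLik c θ x ^ 2) (gaussianReal 0 1) := by
    simp only [hexp]
    exact integrable_finsetSum _ fun a _ => integrable_finsetSum _ fun b _ => hi a b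
  rw [← ofReal_integral_eq_lintegral_ofReal hI (ae_of_all _ fun x => sq_nonneg _)]
  congr 1
  simp only [hexp]
  rw [integral_finsetSum _ fun a _ => integrable_finsetSum _ fun b _ => hi a b]
  refine Finset.sum_congr rfl fun a _ => ?_
  rw [integral_finsetSum _ fun b _ => hi a b]
  exact Finset.sum_congr rfl fun b _ => by rw [integral_const_mul, integral_lik_mul_lik]

end GaussianIntegrals

/-! ### Signed weights with prescribed moments. -/

section LagrangeWeights

open Polynomial

/-- Each factor X - x with |x| ≤ 1 at most doubles the largest coefficient. -/
theorem abs_coeff_prod_linear_le {β : Type*} [DecidableEq β] (s : Finset β) (c x : β → ℝ)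
    (hx : ∀ b, |x b| ≤ 1) (d : ℕ) :
    |(∏ b ∈ s, C (c b) * (X - C (x b))).coeff d| ≤ 2 ^ s.card * ∏ b ∈ s, |c b| := by
  induction s using Finset.induction_on generalizing d with
  | empty =>
    simp only [Finset.prod_empty, Finset.card_empty, pow_zero, mul_one, coeff_one]
    split_ifs <;> simp
  | insert b s hb ih =>
    rw [Finset.prod_insert hb, Finset.prod_insert hb, Finset.card_insert_of_notMem hb, mul_assoc,
      coeff_C_mul, abs_mul, sub_mul, coeff_sub, coeff_C_mul]
    set B := 2 ^ s.card * ∏ b ∈ s, |c b| with hB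
    have hB0 : 0 ≤ B := mul_nonneg (by positivity) (Finset.prod_nonneg fun _ _ => abs_nonneg _)
    have h1 : |(X * ∏ b ∈ s, C (c b) * (X - C (x b))).coeff d| ≤ B := by
      cases d with
      | zero => simpa using hB0
      | succ d => rw [coeff_X_mul]; exact ih d
    have h2 : |x b * (∏ b ∈ s, C (c b) * (X - C (x b))).coeff d| ≤ B := by
      rw [abs_mul]
      calc _ ≤ 1 * B := mul_le_mul (hx b) (ih d) (abs_nonneg _) zero_le_one
        _ = B := one_mul B
    calc _ ≤ |c b| * (B + B) := by
          gcongr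
          exact (abs_sub _ _).trans (add_le_add h1 h2)
      _ = _ := by rw [hB]; ring

/-- The equispaced nodes `a / M` in the unit interval. -/
noncomputable def unitNode (M : ℕ) (a : Fin (M + 1)) : ℝ := (a : ℝ) / M

theorem unitNode_nonneg (M : ℕ) (a : Fin (M + 1)) : 0 ≤ unitNode M a := by
  unfold unitNode; positivity

theorem unitNode_le_one (M : ℕ) (a : Fin (M + 1)) : unitNode M a ≤ 1 := by
  unfold unitNode
  exact div_le_one_of_le₀ (by exact_mod_cast Nat.le_of_lt_succ a.2) (by positivity)

theorem unitNode_injective {M : ℕ} (hM : 0 < M) : Function.Injective (unitNode M) := by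
  intro a b h
  have hM' : (M : ℝ) ≠ 0 := by positivity
  unfold unitNode at h
  rw [div_left_inj' hM'] at h
  exact Fin.ext (by exact_mod_cast h)

/-- The weights on the equispaced nodes all of whose moments up to `M` vanish, but for the
`d`-th, which is one. -/
noncomputable def momentWeight (M d : ℕ) (a : Fin (M + 1)) : ℝ :=
  (Lagrange.basis Finset.univ (unitNode M) a).coeff d

/-- For j ≤ M the monomial X^j is its own Lagrange interpolant on the M + 1 nodes; compare the
coefficients of X^d. -/
theorem sum_momentWeight_mul_pow {M : ℕ} (hM : 0 < M) (d : ℕ) {j : ℕ} (hj : j ≤ M) :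
    ∑ a, momentWeight M d a * unitNode M a ^ j = if j = d then 1 else 0 := by
  have h := Lagrange.eq_interpolate (s := Finset.univ) (v := unitNode M)
    ((unitNode_injective hM).injOn) (f := (X : ℝ[X]) ^ j) (by
      rw [degree_X_pow, Finset.card_univ, Fintype.card_fin]
      exact_mod_cast Nat.lt_succ_of_le hj)
  have h2 := congrArg (fun q => coeff q d) h
  simp only [coeff_X_pow, Lagrange.interpolate_apply, finsetSum_coeff, coeff_C_mul, eval_pow,
    eval_X] at h2
  simp only [momentWeight, mul_comm _ (unitNode M _ ^ j), ← h2, eq_comm]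

theorem prod_abs_sub_eq (M : ℕ) (a : Fin (M + 1)) :
    ∏ i : Fin M, |((a : ℕ) : ℝ) - ((a.succAbove i : Fin (M + 1)) : ℕ)| =
      (a : ℕ).factorial * (M - a).factorial := by
  obtain ⟨a, ha⟩ := a
  obtain ⟨c, rfl⟩ : ∃ c, M = a + c := ⟨M - a, by omega⟩
  obtain ⟨f, hf⟩ : ∃ f : ℕ → ℝ, ∀ i, f i =
      if i < a then ((a - i : ℕ) : ℝ) else ((i + 1 - a : ℕ) : ℝ) := ⟨_, fun _ => rfl⟩
  have h : ∀ i : Fin (a + c), |((a : ℕ) : ℝ) -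
      (((⟨a, ha⟩ : Fin (a + c + 1)).succAbove i : Fin (a + c + 1)) : ℕ)| =
      f i := by
    intro i
    rw [hf]
    by_cases hi : (i : ℕ) < a
    · have : (⟨a, ha⟩ : Fin (a + c + 1)).succAbove i = i.castSucc :=
        Fin.succAbove_of_castSucc_lt _ _ (by simpa [Fin.lt_def] using hi)
      simp only [this, Fin.val_castSucc, hi, if_true]
      rw [Nat.cast_sub hi.le, abs_of_nonneg]
      rw [sub_nonneg]; exact_mod_cast hi.le
    · have : (⟨a, ha⟩ : Fin (a + c + 1)).succAbove i = i.succ :=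
        Fin.succAbove_of_le_castSucc _ _ (by simpa [Fin.le_def] using hi)
      simp only [this, Fin.val_succ, hi, if_false]
      rw [Nat.cast_sub (by omega), abs_sub_comm, abs_of_nonneg]
      rw [sub_nonneg]; exact_mod_cast (by omega : a ≤ i + 1)
  rw [Finset.prod_congr rfl fun i _ => h i, Fin.prod_univ_eq_prod_range, Finset.prod_range_add]
  congr 1
  · rw [← Finset.prod_range_add_one_eq_factorial, ← Finset.prod_range_reflect]
    push_cast
    refine Finset.prod_congr rfl fun i hi => ?_
    have hi := Finset.mem_range.1 hi
    rw [hf, if_pos (by omega)]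
    exact_mod_cast (by omega : a - (a - 1 - i) = i + 1)
  · rw [Nat.add_sub_cancel_left, ← Finset.prod_range_add_one_eq_factorial]
    push_cast
    refine Finset.prod_congr rfl fun i _ => ?_
    rw [hf, if_neg (by omega)]
    exact_mod_cast (by omega : a + i + 1 - a = i + 1)

theorem pow_self_le_four_pow_mul_factorial (M : ℕ) : (M : ℝ) ^ M ≤ 4 ^ M * M.factorial := by
  have h := Real.pow_div_factorial_le_exp (M : ℝ) (by positivity) M
  rw [div_le_iff₀ (by positivity)] at h
  refine h.trans ?_
  gcongr
  rw [← Real.exp_one_rpow, Real.rpow_natCast]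
  gcongr
  linarith [Real.exp_one_lt_d9]

/-- The base 16 is 2 · 4 · 2: the coefficients of the numerator contribute 2^M, while the
denominators a! (M - a)! / M^M contribute 4^M from M^M ≤ 4^M M! and 2^M from the binomial
coefficient. -/
theorem abs_momentWeight_le {M : ℕ} (hM : 0 < M) (d : ℕ) (a : Fin (M + 1)) :
    |momentWeight M d a| ≤ 16 ^ M := by
  have hM' : (0 : ℝ) < M := by exact_mod_cast hM
  have hb := abs_coeff_prod_linear_le (Finset.univ.erase a)
    (fun b => (unitNode M a - unitNode M b)⁻¹) (unitNode M)
    (fun b => abs_le.2 ⟨by linarith [unitNode_nonneg M b], unitNode_le_one M b⟩) d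
  have hprod : ∏ b ∈ Finset.univ.erase a, |unitNode M a - unitNode M b| =
      ((a : ℕ).factorial * (M - a).factorial) / (M : ℝ) ^ M := by
    rw [← prod_abs_sub_eq M a, ← Finset.compl_singleton, ← Fin.image_succAbove_univ,
      Finset.prod_image (fun i _ j _ h => Fin.succAbove_right_injective h), ]
    have : ∀ i : Fin M, |unitNode M a - unitNode M (a.succAbove i)| =
        |((a : ℕ) : ℝ) - ((a.succAbove i : Fin (M + 1)) : ℕ)| / M := by
      intro i
      rw [unitNode, unitNode, ← sub_div, abs_div, abs_of_pos hM']
    simp only [this, Finset.prod_div_distrib, Finset.prod_const, Finset.card_univ,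
      Fintype.card_fin]
  have hcard : (Finset.univ.erase a).card = M := by simp
  simp only [abs_inv, Finset.prod_inv_distrib, hprod, hcard] at hb
  refine hb.trans ?_
  have hchoose : (M.factorial : ℝ) ≤ 2 ^ M * ((a : ℕ).factorial * (M - a).factorial) := by
    have h1 := Nat.choose_mul_factorial_mul_factorial (Nat.le_of_lt_succ a.2)
    have h2 := Nat.choose_le_two_pow M a
    have h3 : M.factorial ≤ 2 ^ M * ((a : ℕ).factorial * (M - a).factorial) := by
      rw [← h1, mul_assoc]; gcongr
    exact_mod_cast h3
  have hpow := pow_self_le_four_pow_mul_factorial M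
  rw [inv_div, ← mul_div_assoc, div_le_iff₀ (by positivity)]
  calc (2 : ℝ) ^ M * M ^ M ≤ 2 ^ M * (4 ^ M * (2 ^ M *
        ((a : ℕ).factorial * (M - a).factorial))) := by
        gcongr
        exact hpow.trans (by gcongr)
    _ = (2 * (4 * 2)) ^ M * ((a : ℕ).factorial * (M - a).factorial) := by
        simp only [mul_pow]; ring
    _ = _ := by norm_num

end LagrangeWeights

/-! ### Linearisation of the posterior moment near the point mass at zero. -/

section Perturbation

variable {A : Type*} [Fintype A]

/-- An envelope uniform over θ in [0, R]: the 1 covers x ≤ 0 and the exponential covers x ≥ 0. -/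
theorem lik_le {R x θ : ℝ} (h0 : 0 ≤ θ) (hR : θ ≤ R) : lik x θ ≤ 1 + Real.exp (R * x) := by
  have hexp : lik x θ ≤ Real.exp (x * θ) := Real.exp_le_exp.2 (by nlinarith [sq_nonneg θ])
  rcases le_total x 0 with hx | hx
  · have : Real.exp (x * θ) ≤ 1 := Real.exp_le_one_iff.2 (mul_nonpos_of_nonpos_of_nonneg hx h0)
    linarith [Real.exp_pos (R * x)]
  · have : Real.exp (x * θ) ≤ Real.exp (R * x) := Real.exp_le_exp.2 (by nlinarith)
    linarith

/-- For a prior close to the point mass at zero, the posterior moment is close to its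
numerator. -/
theorem abs_posteriorMoment_sub_le [DecidableEq A] {p θ : A → ℝ} {k : ℕ} (hk : 1 ≤ k) {R ε : ℝ}
    (hp : ∀ a, 0 ≤ p a) (hp1 : ∑ a, p a = 1) (hθ0 : ∀ a, 0 ≤ θ a) (hθR : ∀ a, θ a ≤ R)
    {a₀ : A} (ha₀ : θ a₀ = 0) (hε : ∑ a ∈ Finset.univ.erase a₀, p a ≤ 2 * ε) {x : ℝ}
    (hl : 1 / 2 ≤ mixLik p θ x) :
    |posteriorMoment k p θ x - mixLik (fun a => p a * θ a ^ k) θ x| ≤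
      8 * ε ^ 2 * R ^ k * (1 + Real.exp (R * x)) ^ 2 := by
  set N := mixLik (fun a => p a * θ a ^ k) θ x with hN
  set l := mixLik p θ x with hl'
  set E := 1 + Real.exp (R * x) with hE
  have hE1 : 1 ≤ E := by rw [hE]; linarith [Real.exp_pos (R * x)]
  have hR0 : 0 ≤ R := (hθ0 a₀).trans (hθR a₀)
  have hlik : ∀ a, lik x (θ a) ≤ E := fun a => lik_le (hθ0 a) (hθR a)
  have hNle : |N| ≤ 2 * ε * (R ^ k * E) := by
    have h0 : N = ∑ a ∈ Finset.univ.erase a₀, p a * θ a ^ k * lik x (θ a) := by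
      rw [hN, mixLik, ← Finset.sum_erase_add _ _ (Finset.mem_univ a₀), ha₀,
        zero_pow (by omega)]
      simp
    have hnn : 0 ≤ N := Finset.sum_nonneg fun a _ =>
      mul_nonneg (mul_nonneg (hp a) (pow_nonneg (hθ0 a) k)) (lik_pos _ _).le
    rw [abs_of_nonneg hnn, h0]
    calc _ ≤ ∑ a ∈ Finset.univ.erase a₀, p a * (R ^ k * E) := by
          refine Finset.sum_le_sum fun a _ => ?_
          rw [mul_assoc]
          exact mul_le_mul_of_nonneg_left (mul_le_mul (pow_le_pow_left₀ (hθ0 a) (hθR a) k)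
            (hlik a) (lik_pos _ _).le (by positivity)) (hp a)
      _ = (∑ a ∈ Finset.univ.erase a₀, p a) * (R ^ k * E) := (Finset.sum_mul _ _ _).symm
      _ ≤ _ := by gcongr
  have hlle : |1 - l| ≤ 2 * ε * E := by
    have h0 : 1 - l = ∑ a ∈ Finset.univ.erase a₀, p a * (1 - lik x (θ a)) := by
      have : 1 - l = ∑ a, p a * (1 - lik x (θ a)) := by
        simp only [mul_sub, mul_one, Finset.sum_sub_distrib, hp1, hl', mixLik]
      rw [this, ← Finset.sum_erase_add _ _ (Finset.mem_univ a₀), ha₀, lik_zero]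
      simp
    rw [h0]
    calc _ ≤ ∑ a ∈ Finset.univ.erase a₀, |p a * (1 - lik x (θ a))| :=
          Finset.abs_sum_le_sum_abs _ _
      _ ≤ ∑ a ∈ Finset.univ.erase a₀, p a * E := by
          refine Finset.sum_le_sum fun a _ => ?_
          rw [abs_mul, abs_of_nonneg (hp a)]
          refine mul_le_mul_of_nonneg_left (abs_le.2 ⟨?_, ?_⟩) (hp a)
          · linarith [hlik a]
          · linarith [lik_pos x (θ a)]
      _ = (∑ a ∈ Finset.univ.erase a₀, p a) * E := (Finset.sum_mul _ _ _).symm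
      _ ≤ _ := by gcongr
  have hlpos : 0 < l := by linarith
  -- Both N and 1 - l are of order ε, as the atom at zero contributes to neither; hence the error is
  -- of order ε².
  have hrho : posteriorMoment k p θ x - N = N * (1 - l) / l := by
    rw [posteriorMoment, ← hN, ← hl']; field_simp
  rw [hrho, abs_div, abs_mul, abs_of_pos hlpos, div_le_iff₀ hlpos]
  calc |N| * |1 - l| ≤ (2 * ε * (R ^ k * E)) * (2 * ε * E) :=
        mul_le_mul hNle hlle (abs_nonneg _) ((abs_nonneg _).trans hNle)
    _ = 8 * ε ^ 2 * R ^ k * E ^ 2 * (1 / 2) := by ring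
    _ ≤ _ := by gcongr

/-- By convexity (1 + y)⁴ ≤ 8 + 8 y⁴, and the Gaussian mean of exp(4Rx) is exp(8R²). -/
theorem lintegral_one_add_exp_pow_four_le {R C : ℝ} (hC : 0 ≤ C) :
    ∫⁻ x, ENNReal.ofReal (C * (1 + Real.exp (R * x)) ^ 4) ∂(gaussianReal 0 1) ≤
      ENNReal.ofReal (C * (16 * Real.exp (8 * R ^ 2))) := by
  have hpt : ∀ x, C * (1 + Real.exp (R * x)) ^ 4 ≤ C * (8 + 8 * Real.exp (4 * R * x)) := by
    intro x
    refine mul_le_mul_of_nonneg_left ?_ hC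
    have h4 : Real.exp (4 * R * x) = Real.exp (R * x) ^ 4 := by
      rw [← Real.exp_nat_mul]; congr 1; push_cast; ring
    rw [h4]
    set y := Real.exp (R * x)
    nlinarith [sq_nonneg (1 - y), sq_nonneg (1 + y), sq_nonneg (1 - y ^ 2),
      mul_nonneg (sq_nonneg (1 - y)) (sq_nonneg (1 + y)), sq_nonneg ((1 - y) * y),
      sq_nonneg ((1 - y) ^ 2)]
  have hi : Integrable (fun x => C * (8 + 8 * Real.exp (4 * R * x))) (gaussianReal 0 1) :=
    ((integrable_const 8).add ((integrable_exp_mul_gaussianReal _).const_mul 8)).const_mul C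
  calc _ ≤ ∫⁻ x, ENNReal.ofReal (C * (8 + 8 * Real.exp (4 * R * x))) ∂(gaussianReal 0 1) :=
        lintegral_mono fun x => ENNReal.ofReal_le_ofReal (hpt x)
    _ = ENNReal.ofReal (C * (8 + 8 * Real.exp (8 * R ^ 2))) := by
        rw [← ofReal_integral_eq_lintegral_ofReal hi (ae_of_all _ fun x => by positivity)]
        congr 1
        rw [integral_const_mul, integral_add (integrable_const 8)
          ((integrable_exp_mul_gaussianReal _).const_mul 8), integral_const_mul,
          integral_exp_mul_gaussianReal_zero_one]
        simp only [integral_const, probReal_univ, one_smul]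
        congr 4; ring
    _ ≤ _ := by
        refine ENNReal.ofReal_le_ofReal (mul_le_mul_of_nonneg_left ?_ hC)
        have : 1 ≤ Real.exp (8 * R ^ 2) := Real.one_le_exp (by positivity)
        linarith

/-- Separation of the posterior moments of priors close to the point mass at zero. -/
theorem ofReal_le_lintegral_sq_posteriorMoment_sub [DecidableEq A] {p q θ : A → ℝ} {k : ℕ}
    (hk : 1 ≤ k) {R ε : ℝ} (hp : ∀ a, 0 ≤ p a) (hp1 : ∑ a, p a = 1) (hq : ∀ a, 0 ≤ q a)
    (hq1 : ∑ a, q a = 1) (hθ0 : ∀ a, 0 ≤ θ a) (hθR : ∀ a, θ a ≤ R) {a₀ : A} (ha₀ : θ a₀ = 0)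
    (hεp : ∑ a ∈ Finset.univ.erase a₀, p a ≤ 2 * ε)
    (hεq : ∑ a ∈ Finset.univ.erase a₀, q a ≤ 2 * ε)
    (hlp : ∀ x, 1 / 2 ≤ mixLik p θ x) (hlq : ∀ x, 1 / 2 ≤ mixLik q θ x) {s : ℝ}
    (hs : ENNReal.ofReal s ≤
      ∫⁻ x, ENNReal.ofReal (mixLik (fun a => (p a - q a) * θ a ^ k) θ x ^ 2) ∂(gaussianReal 0 1)) :
    ENNReal.ofReal (s / 2 - 4096 * ε ^ 4 * R ^ (2 * k) * Real.exp (8 * R ^ 2)) ≤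
      ∫⁻ x, ENNReal.ofReal ((posteriorMoment k p θ x - posteriorMoment k q θ x) ^ 2)
        ∂(gaussianReal 0 1) := by
  have hR0 : 0 ≤ R := (hθ0 a₀).trans (hθR a₀)
  have hpt : ∀ x, ENNReal.ofReal (1 / 2) *
      ENNReal.ofReal (mixLik (fun a => (p a - q a) * θ a ^ k) θ x ^ 2) ≤
      ENNReal.ofReal ((posteriorMoment k p θ x - posteriorMoment k q θ x) ^ 2) +
      ENNReal.ofReal (256 * ε ^ 4 * R ^ (2 * k) * (1 + Real.exp (R * x)) ^ 4) := by
    intro x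
    rw [← ENNReal.ofReal_mul (by norm_num), ← ENNReal.ofReal_add (by positivity) (by positivity)]
    refine ENNReal.ofReal_le_ofReal ?_
    have h1 := abs_posteriorMoment_sub_le hk hp hp1 hθ0 hθR ha₀ hεp (hlp x)
    have h2 := abs_posteriorMoment_sub_le hk hq hq1 hθ0 hθR ha₀ hεq (hlq x)
    have h3 : mixLik (fun a => (p a - q a) * θ a ^ k) θ x =
        mixLik (fun a => p a * θ a ^ k) θ x - mixLik (fun a => q a * θ a ^ k) θ x := by
      simp only [mixLik, ← Finset.sum_sub_distrib]
      exact Finset.sum_congr rfl fun a _ => by ring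
    rw [h3]
    set P := posteriorMoment k p θ x
    set Q := posteriorMoment k q θ x
    set a := mixLik (fun a => p a * θ a ^ k) θ x
    set b := mixLik (fun a => q a * θ a ^ k) θ x
    set B := 8 * ε ^ 2 * R ^ k * (1 + Real.exp (R * x)) ^ 2 with hB
    have e : 256 * ε ^ 4 * R ^ (2 * k) * (1 + Real.exp (R * x)) ^ 4 = (2 * B) ^ 2 := by
      rw [hB, pow_mul']; ring
    rw [e]
    have h4 : |(P - a) - (Q - b)| ≤ 2 * B := (abs_sub _ _).trans (by linarith)
    have h5 : ((P - a) - (Q - b)) ^ 2 ≤ (2 * B) ^ 2 := sq_le_sq' (by linarith [abs_le.1 h4])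
      (abs_le.1 h4).2
    nlinarith [sq_nonneg ((P - Q) + ((P - Q) - (a - b)))]
  have hm1 := measurable_mixLik (fun a => (p a - q a) * θ a ^ k) θ
  have hint := lintegral_mono (μ := gaussianReal 0 1) hpt
  rw [lintegral_add_right _ (by fun_prop), lintegral_const_mul _ (by fun_prop)] at hint
  have h6 := lintegral_one_add_exp_pow_four_le (R := R) (C := 256 * ε ^ 4 * R ^ (2 * k))
    (by positivity)
  have h7 : ENNReal.ofReal (s / 2) ≤
      (∫⁻ x, ENNReal.ofReal ((posteriorMoment k p θ x - posteriorMoment k q θ x) ^ 2)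
        ∂(gaussianReal 0 1)) +
      ENNReal.ofReal (4096 * ε ^ 4 * R ^ (2 * k) * Real.exp (8 * R ^ 2)) := by
    calc ENNReal.ofReal (s / 2) = ENNReal.ofReal (1 / 2) * ENNReal.ofReal s := by
          rw [← ENNReal.ofReal_mul (by norm_num)]; congr 1; ring
      _ ≤ _ := by gcongr
      _ ≤ _ := hint
      _ ≤ _ := by
          refine add_le_add_right (h6.trans (le_of_eq ?_)) _
          congr 1; ring
  rw [ENNReal.ofReal_sub _ (by positivity)]
  exact tsub_le_iff_right.2 h7

end Perturbation

/-! ### Norm of a single direction. -/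

section Moments

/-- The norm of a perturbation of the prior with essentially one non-vanishing moment. -/
theorem sum_exp_momentWeight_le {m d : ℕ} (hm : 1 ≤ m) (hd : m ≤ d) (hd3 : d ≤ 3 * m) {R δ : ℝ}
    (hR : 0 < R) (hRm : R ^ 2 ≤ m / 2 ^ 20) (c : Fin (6 * m + 1) → ℝ)
    (hc : ∀ a, c a = δ * (√(d.factorial) / R ^ d) * momentWeight (6 * m) d a) :
    ∑ a, ∑ b, c a * c b * Real.exp ((R * unitNode (6 * m) a) * (R * unitNode (6 * m) b)) ≤
      2 * δ ^ 2 := by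
  have hsum := hasSum_sq_moment_div_factorial c fun a => R * unitNode (6 * m) a
  set μ : ℕ → ℝ := fun j => ∑ a, momentWeight (6 * m) d a * unitNode (6 * m) a ^ j with hμ
  have hmom : ∀ j, ∑ a, c a * (R * unitNode (6 * m) a) ^ j =
      δ * (√(d.factorial) / R ^ d) * R ^ j * μ j := by
    intro j
    rw [hμ, Finset.mul_sum]
    exact Finset.sum_congr rfl fun a _ => by rw [hc, mul_pow]; ring
  have hμ1 : ∀ j, j ≤ 6 * m → μ j = if j = d then 1 else 0 := fun j hj =>
    sum_momentWeight_mul_pow (by omega) d hj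
  have hμ2 : ∀ j, μ j ^ 2 ≤ 2 ^ (54 * m) := by
    intro j
    have h1 : |μ j| ≤ (6 * m + 1) * 16 ^ (6 * m) := by
      calc |μ j| ≤ ∑ a, |momentWeight (6 * m) d a * unitNode (6 * m) a ^ j| :=
            Finset.abs_sum_le_sum_abs _ _
        _ ≤ ∑ _a : Fin (6 * m + 1), (16 : ℝ) ^ (6 * m) := by
            refine Finset.sum_le_sum fun a _ => ?_
            have h0 := unitNode_nonneg (6 * m) a
            rw [abs_mul, abs_of_nonneg (pow_nonneg h0 j)]
            calc _ ≤ (16 : ℝ) ^ (6 * m) * 1 :=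
                  mul_le_mul (abs_momentWeight_le (by omega) d a)
                    (pow_le_one₀ h0 (unitNode_le_one _ _)) (pow_nonneg h0 j) (by positivity)
              _ = _ := mul_one _
        _ = _ := by simp
    have h2 : (6 * m + 1 : ℝ) ≤ 2 ^ (3 * m) := by
      have := one_add_mul_le_pow (by norm_num : (-2 : ℝ) ≤ 7) m
      rw [pow_mul]; norm_num at this ⊢; linarith
    have h3 : |μ j| ≤ 2 ^ (27 * m) := by
      calc |μ j| ≤ 2 ^ (3 * m) * 16 ^ (6 * m) := h1.trans (by gcongr)
        _ = 2 ^ (27 * m) := by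
          rw [show (16 : ℝ) = 2 ^ 4 by norm_num, ← pow_mul, ← pow_add]; congr 1; ring
    calc μ j ^ 2 = |μ j| ^ 2 := (sq_abs _).symm
      _ ≤ (2 ^ (27 * m)) ^ 2 := by gcongr
      _ = 2 ^ (54 * m) := by rw [← pow_mul]; congr 1; ring
  have hbound : ∀ j, (∑ a, c a * (R * unitNode (6 * m) a) ^ j) ^ 2 / (j.factorial : ℝ) ≤
      δ ^ 2 * (if j = d then 1 else 0) + δ ^ 2 / 2 * (1 / 2) ^ j := by
    intro j
    have hsq : (√(d.factorial : ℝ)) ^ 2 = d.factorial := Real.sq_sqrt (by positivity)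
    rw [hmom]
    -- Up to order 6m only j = d contributes, giving δ²; the higher orders form a tail bounded by a
    -- geometric series of total at most δ².
    rcases le_or_gt j (6 * m) with hj | hj
    · rw [hμ1 j hj]
      split_ifs with hjd
      · subst hjd
        have : (δ * (√(j.factorial : ℝ) / R ^ j) * R ^ j * 1) ^ 2 / (j.factorial : ℝ) = δ ^ 2 := by
          field_simp
          rw [hsq]
        rw [this]
        have : 0 ≤ δ ^ 2 / 2 * (1 / 2) ^ j := by positivity
        linarith
      · simp; positivity
    · rw [if_neg (by omega)]
      obtain ⟨e, rfl⟩ : ∃ e, j = d + e := ⟨j - d, by omega⟩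
      have hfac : (d.factorial : ℝ) * (d + 1) ^ e ≤ (d + e).factorial := by
        exact_mod_cast Nat.factorial_mul_pow_le_factorial
      have hRe : (R ^ 2) ^ e ≤ (d + 1) ^ e * (1 / 2 ^ 20) ^ e := by
        rw [← mul_pow]
        refine pow_le_pow_left₀ (by positivity) (hRm.trans ?_) e
        rw [mul_one_div]
        gcongr
        have : (m : ℝ) ≤ d := by exact_mod_cast hd
        linarith
      have h1 : (δ * (√(d.factorial : ℝ) / R ^ d) * R ^ (d + e) * μ (d + e)) ^ 2 =
          δ ^ 2 * (d.factorial * (R ^ 2) ^ e * μ (d + e) ^ 2) := by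
        have : δ * (√(d.factorial : ℝ) / R ^ d) * R ^ (d + e) * μ (d + e) =
            δ * (√(d.factorial : ℝ) * R ^ e * μ (d + e)) := by
          rw [pow_add]; field_simp
        rw [this, mul_pow, mul_pow, mul_pow, hsq, ← pow_mul, ← pow_mul, mul_comm e 2]
      rw [h1, mul_zero, zero_add, div_le_iff₀ (by positivity)]
      -- The choice of 2^20: since d ≤ 3m and d + e > 6m, e exceeds 3m, so 19 e ≥ 57 m + 19 ≥ 54 m +
      -- d + 1.
      have h2 : (1 / 2 ^ 20 : ℝ) ^ e * 2 ^ (54 * m) ≤ 1 / 2 * (1 / 2) ^ (d + e) := by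
        rw [← pow_succ', div_pow, div_pow, one_pow, one_pow, ← pow_mul, div_mul_eq_mul_div,
          one_mul, div_le_div_iff₀ (by positivity) (by positivity), one_mul, ← pow_add]
        exact pow_le_pow_right₀ (by norm_num) (by omega)
      calc δ ^ 2 * (d.factorial * (R ^ 2) ^ e * μ (d + e) ^ 2)
          ≤ δ ^ 2 * (d.factorial * ((d + 1) ^ e * (1 / 2 ^ 20) ^ e) * 2 ^ (54 * m)) := by
            gcongr
            exact hμ2 _
        _ = δ ^ 2 * ((1 / 2 ^ 20 : ℝ) ^ e * 2 ^ (54 * m)) * (d.factorial * (d + 1) ^ e) := by ring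
        _ ≤ δ ^ 2 * (1 / 2 * (1 / 2) ^ (d + e)) * (d + e).factorial := by gcongr
        _ = _ := by ring
  have hb : HasSum (fun j : ℕ => δ ^ 2 * (if j = d then 1 else 0) + δ ^ 2 / 2 * (1 / 2) ^ j)
      (δ ^ 2 * 1 + δ ^ 2 / 2 * 2) :=
    ((hasSum_ite_eq d (1 : ℝ)).mul_left _).add (hasSum_geometric_two.mul_left _)
  have := hasSum_le hbound hsum hb
  linarith

end Moments

/-! ### The hypercube of priors and its regret bound. -/

section Hypercube

/-- The support of the hypercube of priors. -/
noncomputable def cubeNode (m : ℕ) (R : ℝ) (a : Fin (6 * m + 1)) : ℝ := R * unitNode (6 * m) a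

/-- The `i`-th direction of perturbation, whose moments up to order `6 * m` vanish, but for the
one of order `m + i + k`. -/
noncomputable def cubeDir (k m : ℕ) (R δ : ℝ) (i : Fin m) (a : Fin (6 * m + 1)) : ℝ :=
  δ * (√((m + i + k).factorial) / R ^ (m + i + k)) * momentWeight (6 * m) (m + i + k) a

/-- The hypercube of perturbations of a prior which is close to the point mass at zero. -/
noncomputable def cubeWeight (k m : ℕ) (R δ ε : ℝ) (u : Fin m → Bool) (a : Fin (6 * m + 1)) : ℝ :=
  (if a = 0 then 1 - ε else 0) + ε / (6 * m + 1) + ∑ i, signVal (u i) * cubeDir k m R δ i a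

variable {k m : ℕ} {R δ ε S : ℝ}

theorem cubeNode_zero : cubeNode m R 0 = 0 := by simp [cubeNode, unitNode]

theorem cubeNode_nonneg (hR : 0 < R) (a : Fin (6 * m + 1)) : 0 ≤ cubeNode m R a :=
  mul_nonneg hR.le (unitNode_nonneg _ _)

theorem cubeNode_le (hR : 0 < R) (a : Fin (6 * m + 1)) : cubeNode m R a ≤ R :=
  mul_le_of_le_one_right hR.le (unitNode_le_one _ _)

theorem sum_cubeDir_mul_pow (hk : 1 ≤ k) (hkm : k ≤ m) (hR : 0 < R) (i : Fin m) {j : ℕ}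
    (hj : j ≤ 6 * m) :
    ∑ a, cubeDir k m R δ i a * cubeNode m R a ^ j =
      if j = m + i + k then δ * √((m + i + k).factorial) else 0 := by
  have h : ∀ a, cubeDir k m R δ i a * cubeNode m R a ^ j =
      δ * (√((m + i + k).factorial) / R ^ (m + i + k)) * R ^ j *
        (momentWeight (6 * m) (m + i + k) a * unitNode (6 * m) a ^ j) := by
    intro a; rw [cubeDir, cubeNode, mul_pow]; ring
  simp only [h, ← Finset.mul_sum]
  rw [sum_momentWeight_mul_pow (by omega) _ hj]
  split_ifs with hji
  · subst hji; field_simp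
  · simp

theorem sum_cubeWeight (hk : 1 ≤ k) (hkm : k ≤ m) (hR : 0 < R) (u : Fin m → Bool) :
    ∑ a, cubeWeight k m R δ ε u a = 1 := by
  have h0 : ∀ i : Fin m, ∑ a, cubeDir k m R δ i a = 0 := by
    intro i
    have := sum_cubeDir_mul_pow (δ := δ) hk hkm hR i (Nat.zero_le _)
    simp only [pow_zero, mul_one] at this
    rw [this, if_neg (by omega)]
  simp only [cubeWeight, Finset.sum_add_distrib]
  rw [Finset.sum_comm (f := fun a i => signVal (u i) * cubeDir k m R δ i a)]
  simp only [← Finset.mul_sum, h0, mul_zero, Finset.sum_const_zero, add_zero,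
    Finset.sum_ite_eq', Finset.mem_univ, if_true, Finset.sum_const, Finset.card_univ,
    Fintype.card_fin, nsmul_eq_mul]
  push_cast
  field_simp
  ring

/-- The uniform component of `cubeWeight` puts ε / (6m + 1) on every node; this bound keeps the
perturbed weights nonnegative. -/
theorem abs_sum_cubeDir_le (hk : 1 ≤ k) (hkm : k ≤ m) (hR : 0 < R) (hδ : 0 < δ)
    (hS : ∀ d ≤ 3 * m, √(d.factorial) / R ^ d ≤ S)
    (hε : (6 * m + 1) * (m * (δ * S * 16 ^ (6 * m))) ≤ ε)
    (u : Fin m → Bool) (a : Fin (6 * m + 1)) :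
    |∑ i, signVal (u i) * cubeDir k m R δ i a| ≤ ε / (6 * m + 1) := by
  calc _ ≤ ∑ i, |signVal (u i) * cubeDir k m R δ i a| := Finset.abs_sum_le_sum_abs _ _
    _ ≤ ∑ _i : Fin m, δ * S * 16 ^ (6 * m) := by
        refine Finset.sum_le_sum fun i _ => ?_
        have h1 := hS (m + i + k) (by omega)
        have h0 : 0 ≤ √((m + i + k).factorial) / R ^ (m + i + k) := by positivity
        rw [abs_mul, abs_signVal, one_mul, cubeDir, abs_mul, abs_mul, abs_of_pos hδ,
          abs_of_nonneg h0]
        have h2 : 0 ≤ S := h0.trans h1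
        gcongr
        exact abs_momentWeight_le (by omega) _ _
    _ = m * (δ * S * 16 ^ (6 * m)) := by simp
    _ ≤ _ := by
        rw [le_div_iff₀ (by positivity)]
        linarith

theorem cubeWeight_sub (u v : Fin m → Bool) (a : Fin (6 * m + 1)) :
    cubeWeight k m R δ ε u a - cubeWeight k m R δ ε v a =
      ∑ i, (signVal (u i) - signVal (v i)) * cubeDir k m R δ i a := by
  simp only [cubeWeight, sub_mul, Finset.sum_sub_distrib]
  ring

theorem cubeWeight_sub_flipSign (u : Fin m → Bool) (i : Fin m) (a : Fin (6 * m + 1)) :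
    cubeWeight k m R δ ε u a - cubeWeight k m R δ ε (flipSign i u) a =
      2 * signVal (u i) * cubeDir k m R δ i a := by
  rw [cubeWeight_sub, Finset.sum_eq_single i]
  · simp only [flipSign, Function.update_self, signVal_not]; ring
  · intro j _ hj
    simp [flipSign, hj]
  · simp

/-- Neighbours differ by twice one direction, of squared norm at most 2 δ². -/
theorem lintegral_sq_mixLik_cube_sub_le (hk : 1 ≤ k) (hkm : k ≤ m) (hR : 0 < R)
    (hRm : R ^ 2 ≤ m / 2 ^ 20) (i : Fin m) (u : Fin m → Bool) :
    ∫⁻ x, ENNReal.ofReal ((mixLik (cubeWeight k m R δ ε u) (cubeNode m R) x -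
      mixLik (cubeWeight k m R δ ε (flipSign i u)) (cubeNode m R) x) ^ 2) ∂(gaussianReal 0 1) ≤
      ENNReal.ofReal (8 * δ ^ 2) := by
  have h : ∀ x, (mixLik (cubeWeight k m R δ ε u) (cubeNode m R) x -
      mixLik (cubeWeight k m R δ ε (flipSign i u)) (cubeNode m R) x) ^ 2 =
      4 * mixLik (cubeDir k m R δ i) (cubeNode m R) x ^ 2 := by
    intro x
    have : mixLik (cubeWeight k m R δ ε u) (cubeNode m R) x -
      mixLik (cubeWeight k m R δ ε (flipSign i u)) (cubeNode m R) x =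
        2 * signVal (u i) * mixLik (cubeDir k m R δ i) (cubeNode m R) x := by
      simp only [mixLik, ← Finset.sum_sub_distrib, ← sub_mul, cubeWeight_sub_flipSign,
        Finset.mul_sum]
      exact Finset.sum_congr rfl fun a _ => by ring
    rw [this, mul_pow, mul_pow, sq_signVal]
    ring
  simp only [h, ENNReal.ofReal_mul (zero_le_four : (0 : ℝ) ≤ 4)]
  have hm := measurable_mixLik (cubeDir k m R δ i) (cubeNode m R)
  rw [lintegral_const_mul _ (by fun_prop), lintegral_sq_mixLik,
    ← ENNReal.ofReal_mul zero_le_four]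
  refine ENNReal.ofReal_le_ofReal ?_
  have := sum_exp_momentWeight_le (d := m + i + k) (δ := δ) (by omega) (by omega) (by omega) hR hRm
    (cubeDir k m R δ i) fun a => rfl
  simp only [cubeNode]
  linarith

/-- In the moment series keep only the orders m + i. With the factor θ^k, order m + i sees the
moment of order m + i + k, which is nonzero for direction i alone, and (m + i + k)! / (m + i)! ≥
m^k. -/
theorem ofReal_hammingDist_le (hk : 1 ≤ k) (hkm : k ≤ m) (hR : 0 < R) (u v : Fin m → Bool) :
    ENNReal.ofReal (4 * (δ ^ 2 * m ^ k) * hammingDist u v) ≤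
      ∫⁻ x, ENNReal.ofReal (mixLik (fun a => (cubeWeight k m R δ ε u a -
        cubeWeight k m R δ ε v a) * cubeNode m R a ^ k) (cubeNode m R) x ^ 2)
        ∂(gaussianReal 0 1) := by
  rw [lintegral_sq_mixLik]
  refine ENNReal.ofReal_le_ofReal ?_
  have hsum := hasSum_sq_moment_div_factorial (fun a => (cubeWeight k m R δ ε u a -
        cubeWeight k m R δ ε v a) * cubeNode m R a ^ k) (cubeNode m R)
  have hle := sum_le_hasSum (Finset.univ.map ⟨fun i : Fin m => m + (i : ℕ), fun i j h => by
    simpa [Fin.ext_iff] using h⟩) (fun j _ => by positivity) hsum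
  refine le_trans ?_ hle
  rw [Finset.sum_map]
  have hterm : ∀ i : Fin m, 4 * (δ ^ 2 * m ^ k) * (if u i ≠ v i then 1 else 0) ≤
      (∑ a, (cubeWeight k m R δ ε u a - cubeWeight k m R δ ε v a) * cubeNode m R a ^ k *
        cubeNode m R a ^ (m + (i : ℕ))) ^ 2 / ((m + (i : ℕ)).factorial : ℝ) := by
    intro i
    have h1 : ∑ a, (cubeWeight k m R δ ε u a - cubeWeight k m R δ ε v a) * cubeNode m R a ^ k *
        cubeNode m R a ^ (m + (i : ℕ)) =
        (signVal (u i) - signVal (v i)) * (δ * √((m + i + k).factorial)) := by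
      have h2 : ∀ a, (cubeWeight k m R δ ε u a - cubeWeight k m R δ ε v a) * cubeNode m R a ^ k *
        cubeNode m R a ^ (m + (i : ℕ)) = ∑ l, (signVal (u l) - signVal (v l)) *
          (cubeDir k m R δ l a * cubeNode m R a ^ (m + i + k)) := by
        intro a
        rw [cubeWeight_sub, mul_assoc, ← pow_add, Finset.sum_mul, add_comm k]
        exact Finset.sum_congr rfl fun l _ => by ring
      simp only [h2]
      rw [Finset.sum_comm]
      simp only [← Finset.mul_sum]
      rw [Finset.sum_eq_single i]
      · rw [sum_cubeDir_mul_pow hk hkm hR i (by omega), if_pos rfl]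
      · intro l _ hl
        rw [sum_cubeDir_mul_pow hk hkm hR l (by omega), if_neg, mul_zero]
        intro h; exact hl (Fin.ext (by omega))
      · simp
    rw [h1, mul_pow, sq_signVal_sub, mul_pow, Real.sq_sqrt (by positivity),
      le_div_iff₀ (by positivity)]
    have hfac : ((m + (i : ℕ)).factorial : ℝ) * m ^ k ≤ (m + i + k).factorial := by
      have h3 : (m + (i : ℕ)).factorial * m ^ k ≤ (m + i + k).factorial :=
        (Nat.mul_le_mul_left _ (Nat.pow_le_pow_left (by omega) k)).trans
          Nat.factorial_mul_pow_le_factorial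
      exact_mod_cast h3
    calc 4 * (δ ^ 2 * m ^ k) * (if u i ≠ v i then 1 else 0) * ((m + (i : ℕ)).factorial : ℝ)
        = (4 * if u i ≠ v i then 1 else 0) * (δ ^ 2 * (((m + (i : ℕ)).factorial : ℝ) * m ^ k)) := by
          ring
      _ ≤ _ := by
          refine mul_le_mul_of_nonneg_left (by gcongr) ?_
          split_ifs <;> norm_num
  refine le_trans (le_of_eq ?_) (Finset.sum_le_sum fun i _ => hterm i)
  rw [← Finset.mul_sum, hammingDist, Finset.card_filter]
  push_cast
  rfl

/-- The lower bound on the minimax regret from the hypercube of priors, in terms of its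
parameters. -/
theorem le_minimaxTotRegret_of_parameters (hk : 1 ≤ k) (hkm : k ≤ m) (n : ℕ) (hR : 0 < R)
    (hδ : 0 < δ) (hRm : R ^ 2 ≤ m / 2 ^ 20) (hS : ∀ d ≤ 3 * m, √(d.factorial) / R ^ d ≤ S)
    (hε : (6 * m + 1) * (m * (δ * S * 16 ^ (6 * m))) ≤ ε) (hε4 : ε ≤ 1 / 4)
    (herr : 4096 * ε ^ 4 * R ^ (2 * k) * Real.exp (8 * R ^ 2) ≤ δ ^ 2)
    (hn : n * δ ^ 2 ≤ 1 / 40) (G : Set (Measure ℝ))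
    (hG : ∀ π : Measure ℝ, IsProbabilityMeasure π → π (Set.Icc (-R) R) = 1 →
      π {0}ᶜ ≤ ENNReal.ofReal (2 * ε) → π ∈ G) :
    (((n + 1 : ℕ) * (m * (δ ^ 2 * m ^ k) * (3 / 32)) : ℝ) : EReal) ≤
      EmpiricalBayes.minimaxTotRegret normalMeans (fun θ => θ ^ k) (n + 1) G := by
  have hS0 : 0 ≤ S := le_trans (by positivity) (hS 0 (Nat.zero_le _))
  have hε0 : 0 ≤ ε := le_trans (by positivity) hε
  have habs := abs_sum_cubeDir_le hk hkm hR hδ hS hε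
  have hp : ∀ u a, 0 ≤ cubeWeight k m R δ ε u a := by
    intro u a
    have := abs_le.1 (habs u a)
    rw [cubeWeight]
    split_ifs <;> linarith
  have hp1 : ∀ u, ∑ a, cubeWeight k m R δ ε u a = 1 := sum_cubeWeight hk hkm hR
  have hrest : ∀ u, ∑ a ∈ Finset.univ.erase 0, cubeWeight k m R δ ε u a ≤ 2 * ε := by
    intro u
    calc _ ≤ ∑ _a ∈ (Finset.univ : Finset (Fin (6 * m + 1))).erase 0,
          2 * (ε / (6 * m + 1)) := by
          refine Finset.sum_le_sum fun a ha => ?_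
          have := abs_le.1 (habs u a)
          rw [cubeWeight, if_neg (Finset.ne_of_mem_erase ha)]
          linarith
      _ ≤ ∑ _a : Fin (6 * m + 1), 2 * (ε / (6 * m + 1)) :=
          Finset.sum_le_sum_of_subset_of_nonneg (Finset.erase_subset _ _)
            fun _ _ _ => by positivity
      _ = 2 * ε := by
          simp only [Finset.sum_const, Finset.card_univ, Fintype.card_fin, nsmul_eq_mul]
          push_cast; field_simp
  have hzero : ∀ u, 1 - 2 * ε ≤ cubeWeight k m R δ ε u 0 := by
    intro u
    have := hp1 u
    rw [← Finset.sum_erase_add _ _ (Finset.mem_univ 0)] at this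
    linarith [hrest u]
  -- The atom at zero has likelihood ratio 1 and mass at least 1 - 2ε ≥ 1/2.
  have hl : ∀ u x, 1 / 2 ≤ mixLik (cubeWeight k m R δ ε u) (cubeNode m R) x := by
    intro u x
    have h1 : cubeWeight k m R δ ε u 0 * lik x (cubeNode m R 0) ≤
        mixLik (cubeWeight k m R δ ε u) (cubeNode m R) x :=
      Finset.single_le_sum (f := fun a => cubeWeight k m R δ ε u a * lik x (cubeNode m R a))
        (fun a _ => mul_nonneg (hp u a) (lik_pos _ _).le) (Finset.mem_univ 0)
    rw [cubeNode_zero, lik_zero, mul_one] at h1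
    linarith [hzero u]
  have hmem : ∀ u, finPrior (cubeWeight k m R δ ε u) (cubeNode m R) ∈ G := by
    intro u
    refine hG _ (finPrior_isProbabilityMeasure _ (hp u) (hp1 u)) ?_ ?_
    · simp only [finPrior, Measure.coe_finsetSum, Finset.sum_apply, Measure.smul_apply,
        smul_eq_mul]
      have : ∀ a, Measure.dirac (cubeNode m R a) (Set.Icc (-R) R) = 1 := fun a => by
        rw [Measure.dirac_apply' _ measurableSet_Icc, Set.indicator_of_mem]
        · rfl
        · exact ⟨by linarith [cubeNode_nonneg hR a], cubeNode_le hR a⟩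
      simp only [this, mul_one]
      rw [← ENNReal.ofReal_sum_of_nonneg fun a _ => hp u a, hp1, ENNReal.ofReal_one]
    · simp only [finPrior, Measure.coe_finsetSum, Finset.sum_apply, Measure.smul_apply,
        smul_eq_mul]
      rw [← Finset.sum_erase_add _ _ (Finset.mem_univ 0), cubeNode_zero,
        Measure.dirac_apply' _ (measurableSet_singleton _).compl,
        Set.indicator_of_notMem (by simp), mul_zero, add_zero]
      calc _ ≤ ∑ a ∈ Finset.univ.erase 0, ENNReal.ofReal (cubeWeight k m R δ ε u a) := by
            refine Finset.sum_le_sum fun a _ => ?_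
            exact mul_le_of_le_one_right' prob_le_one
        _ = ENNReal.ofReal (∑ a ∈ Finset.univ.erase 0, cubeWeight k m R δ ε u a) :=
            (ENNReal.ofReal_sum_of_nonneg fun a _ => hp u a).symm
        _ ≤ _ := ENNReal.ofReal_le_ofReal (hrest u)
  have hη1 : (1 + 2 * (8 * δ ^ 2)) ^ n ≤ 3 / 2 := by
    have h1 : 1 + 2 * (8 * δ ^ 2) ≤ Real.exp (16 * δ ^ 2) := by
      linarith [Real.add_one_le_exp (16 * δ ^ 2)]
    calc (1 + 2 * (8 * δ ^ 2)) ^ n ≤ Real.exp (16 * δ ^ 2) ^ n := by gcongr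
      _ = Real.exp (16 * (n * δ ^ 2)) := by rw [← Real.exp_nat_mul]; congr 1; ring
      _ ≤ Real.exp (2 / 5) := Real.exp_le_exp.2 (by linarith)
      _ ≤ 3 / 2 := by
        have h5 : Real.exp (2 / 5) ^ 5 ≤ (3 / 2) ^ 5 := by
          rw [← Real.exp_nat_mul]
          have h2 : Real.exp ((5 : ℕ) * (2 / 5)) = Real.exp 1 ^ 2 := by
            rw [← Real.exp_nat_mul]; norm_num
          rw [h2]
          have := Real.exp_one_lt_d9
          nlinarith [Real.exp_pos 1]
        exact le_of_pow_le_pow_left₀ (by norm_num) (by norm_num) h5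
  have hm1 : (1 : ℝ) ≤ m := by exact_mod_cast hk.trans hkm
  have hmain := le_minimaxTotRegret_of_hypercube k n G (cubeNode m R) (cubeWeight k m R δ ε) hp hp1
    hl hmem (η := 8 * δ ^ 2) (by positivity) hη1
    (fun i u => lintegral_sq_mixLik_cube_sub_le hk hkm hR hRm i u) (lam := δ ^ 2 * m ^ k)
    (by positivity) (fun u v => by
      -- For distinct patterns the distance is at least 1, so half the linear separation, 2 δ² m^k
      -- times the distance, absorbs the error δ² and leaves the required amount.
      rcases Nat.eq_zero_or_pos (hammingDist u v) with h0 | h0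
      · simp [h0]
      refine le_trans (ENNReal.ofReal_le_ofReal ?_) (ofReal_le_lintegral_sq_posteriorMoment_sub hk
        (hp u) (hp1 u) (hp v) (hp1 v) (cubeNode_nonneg hR) (cubeNode_le hR) cubeNode_zero (hrest u)
        (hrest v) (hl u) (hl v) (ofReal_hammingDist_le hk hkm hR u v))
      have h1 : (1 : ℝ) ≤ hammingDist u v := by exact_mod_cast h0
      have h2 : (1 : ℝ) ≤ m ^ k := one_le_pow₀ hm1
      have h3 : δ ^ 2 ≤ δ ^ 2 * m ^ k * hammingDist u v := by
        have : δ ^ 2 * 1 * 1 ≤ δ ^ 2 * m ^ k * hammingDist u v := by gcongr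
        linarith
      linarith)
  simpa using hmain

end Hypercube

/-! ### Choice of parameters and the two rates. -/

section Rates

open Filter Topology

theorem sqrt_factorial_div_pow_le {m : ℕ} {R B : ℝ} (hR : 0 < R) (hB : 1 ≤ B)
    (h : √(3 * m) ≤ R * B) {d : ℕ} (hd : d ≤ 3 * m) :
    √(d.factorial) / R ^ d ≤ Real.exp (3 * m * Real.log B) := by
  have h1 : √(d.factorial : ℝ) ≤ √(3 * m) ^ d := by
    refine Real.sqrt_le_iff.2 ⟨by positivity, ?_⟩
    rw [← pow_mul, mul_comm d, pow_mul, Real.sq_sqrt (by positivity)]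
    have : d.factorial ≤ (3 * m) ^ d := d.factorial_le_pow.trans (Nat.pow_le_pow_left hd d)
    exact_mod_cast this
  calc √(d.factorial : ℝ) / R ^ d ≤ (R * B) ^ d / R ^ d := by
        gcongr
        exact h1.trans (by gcongr)
    _ = B ^ d := by rw [mul_pow]; field_simp
    _ ≤ B ^ (3 * m) := pow_le_pow_right₀ hB hd
    _ = _ := by
      rw [show (3 * m * Real.log B : ℝ) = ((3 * m : ℕ) : ℝ) * Real.log B by push_cast; ring,
        Real.exp_nat_mul, Real.exp_log (by linarith)]

/-- The lower bound on the minimax regret for samples that are exponentially large in the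
dimension of the hypercube. -/
theorem le_minimaxTotRegret_of_log {k m : ℕ} (hk : 1 ≤ k) (hkm : k ≤ m) {N : ℕ} (hN : 1 ≤ N)
    {R σ : ℝ} (hR : 0 < R) (hRm : R ^ 2 ≤ m / 2 ^ 20)
    (hS : ∀ d ≤ 3 * m, √(d.factorial) / R ^ d ≤ Real.exp σ)
    (hlog : 109 * m + (8 + k) * R ^ 2 + 4 * σ ≤ Real.log N) (G : Set (Measure ℝ))
    (hG : ∀ π : Measure ℝ, IsProbabilityMeasure π → π (Set.Icc (-R) R) = 1 →
      π {0}ᶜ ≤ ENNReal.ofReal (2 * Real.exp (25 * m + σ - Real.log N / 2)) → π ∈ G) :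
    ((3 / 1280 * (m : ℝ) ^ (k + 1) : ℝ) : EReal) ≤
      EmpiricalBayes.minimaxTotRegret normalMeans (fun θ => θ ^ k) N G := by
  obtain ⟨n, rfl⟩ : ∃ n, N = n + 1 := ⟨N - 1, by omega⟩
  have hNpos : (0 : ℝ) < ((n + 1 : ℕ) : ℝ) := by positivity
  have hm1 : (1 : ℝ) ≤ m := by exact_mod_cast hk.trans hkm
  have hσ : 0 ≤ σ := by
    have := hS 0 (Nat.zero_le _)
    simpa using this
  -- The 40 gives (1 + 16 δ²)^n ≤ exp(2/5) ≤ 3/2.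
  set δ : ℝ := √(1 / (40 * (n + 1 : ℕ))) with hδ
  have hδ2 : δ ^ 2 = 1 / (40 * (n + 1 : ℕ)) := Real.sq_sqrt (by positivity)
  have hδ0 : 0 < δ := Real.sqrt_pos.2 (by positivity)
  set E : ℝ := (6 * m + 1) * (m * (Real.exp σ * 16 ^ (6 * m))) with hE
  have hE0 : 0 ≤ E := by positivity
  -- 25 = 6 + 1 + 18, from the three factors 6m + 1, m and 16^(6m). Below, 109 = 9 + 4 · 25, where 9
  -- pays for the constant 4096.
  have hEle : E ≤ Real.exp (25 * m + σ) := by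
    have h1 : (6 * m + 1 : ℝ) ≤ Real.exp (6 * m) := Real.add_one_le_exp _
    have h2 : (m : ℝ) ≤ Real.exp m := by linarith [Real.add_one_le_exp (m : ℝ)]
    have h3 : (16 : ℝ) ^ (6 * m) ≤ Real.exp (18 * m) := by
      have h4 : (16 : ℝ) ≤ Real.exp 3 := by
        have : Real.exp 3 = Real.exp 1 ^ 3 := by rw [← Real.exp_nat_mul]; norm_num
        rw [this]
        calc (16 : ℝ) ≤ 2.6 ^ 3 := by norm_num
          _ ≤ _ := by
            gcongr
            linarith [Real.exp_one_gt_d9]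
      calc (16 : ℝ) ^ (6 * m) ≤ Real.exp 3 ^ (6 * m) := by gcongr
        _ = _ := by rw [← Real.exp_nat_mul]; congr 1; push_cast; ring
    calc E ≤ Real.exp (6 * m) * (Real.exp m * (Real.exp σ * Real.exp (18 * m))) := by
          rw [hE]; gcongr
      _ = _ := by rw [← Real.exp_add, ← Real.exp_add, ← Real.exp_add]; congr 1; ring
  have hNexp : Real.exp (109 * m + (8 + k) * R ^ 2 + 4 * σ) ≤ (n + 1 : ℕ) := by
    rw [← Real.exp_log hNpos]
    exact Real.exp_le_exp.2 hlog
  have hδexp : δ ≤ Real.exp (-(Real.log (n + 1 : ℕ) / 2)) := by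
    have h1 : Real.exp (-(Real.log (n + 1 : ℕ) / 2)) ^ 2 = 1 / (n + 1 : ℕ) := by
      rw [← Real.exp_nat_mul]
      have : ((2 : ℕ) : ℝ) * -(Real.log (n + 1 : ℕ) / 2) = -Real.log (n + 1 : ℕ) := by
        push_cast; ring
      rw [this, Real.exp_neg, Real.exp_log hNpos, one_div]
    refine le_of_sq_le_sq ?_ (Real.exp_pos _).le
    rw [h1, hδ2]
    gcongr
    linarith
  have hδE : δ * E ≤ Real.exp (25 * m + σ - Real.log (n + 1 : ℕ) / 2) := by
    calc δ * E ≤ Real.exp (-(Real.log (n + 1 : ℕ) / 2)) * Real.exp (25 * m + σ) := by gcongr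
      _ = _ := by rw [← Real.exp_add]; congr 1; ring
  have hfour : δ * E ≤ 1 / 4 := by
    refine hδE.trans ?_
    calc Real.exp (25 * m + σ - Real.log (n + 1 : ℕ) / 2) ≤ Real.exp (-4) := by
          refine Real.exp_le_exp.2 ?_
          have : 0 ≤ (8 + k) * R ^ 2 := by positivity
          linarith
      _ ≤ 1 / 4 := by
          rw [Real.exp_neg, one_div]
          gcongr
          linarith [Real.add_one_le_exp (4 : ℝ)]
  have hE4 : 4096 * E ^ 4 * R ^ (2 * k) * Real.exp (8 * R ^ 2) ≤ 40 * (n + 1 : ℕ) := by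
    have h1 : (4096 : ℝ) ≤ 40 * Real.exp (9 * m) := by
      have h2 : (512 : ℝ) ≤ Real.exp (9 * m) := by
        calc (512 : ℝ) = 2 ^ 9 := by norm_num
          _ ≤ Real.exp 1 ^ 9 := by
            gcongr
            linarith [Real.exp_one_gt_d9]
          _ = Real.exp 9 := by rw [← Real.exp_nat_mul]; norm_num
          _ ≤ _ := Real.exp_le_exp.2 (by linarith)
      linarith
    have h2 : R ^ (2 * k) ≤ Real.exp (k * R ^ 2) := by
      rw [pow_mul, Real.exp_nat_mul]
      gcongr
      linarith [Real.add_one_le_exp (R ^ 2)]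
    calc 4096 * E ^ 4 * R ^ (2 * k) * Real.exp (8 * R ^ 2)
        ≤ (40 * Real.exp (9 * m)) * Real.exp (25 * m + σ) ^ 4 * Real.exp (k * R ^ 2) *
          Real.exp (8 * R ^ 2) := by gcongr
      _ = 40 * Real.exp (109 * m + (8 + k) * R ^ 2 + 4 * σ) := by
          rw [← Real.exp_nat_mul, mul_assoc 40, mul_assoc 40, mul_assoc 40, ← Real.exp_add,
            ← Real.exp_add, ← Real.exp_add]
          congr 2; push_cast; ring
      _ ≤ _ := by gcongr
  have hmain := le_minimaxTotRegret_of_parameters (δ := δ) (ε := δ * E) (S := Real.exp σ) hk hkm n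
    hR hδ0 hRm hS (le_of_eq (by rw [hE]; ring)) hfour (by
      have h5 : δ ^ 2 * (40 * (n + 1 : ℕ)) = 1 := by rw [hδ2]; field_simp
      calc 4096 * (δ * E) ^ 4 * R ^ (2 * k) * Real.exp (8 * R ^ 2)
          = δ ^ 2 * (δ ^ 2 * (4096 * E ^ 4 * R ^ (2 * k) * Real.exp (8 * R ^ 2))) := by ring
        _ ≤ δ ^ 2 * (δ ^ 2 * (40 * (n + 1 : ℕ))) := by gcongr
        _ = δ ^ 2 := by rw [h5, mul_one]) (by
      rw [hδ2, mul_one_div, div_le_div_iff₀ (by positivity) (by norm_num)]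
      push_cast; linarith) G (fun π h1 h2 h3 => hG π h1 h2 (h3.trans (ENNReal.ofReal_le_ofReal
        (by linarith))))
  refine le_trans (le_of_eq ?_) hmain
  congr 1
  rw [hδ2]
  field_simp
  ring

/-- The minimax regret is positive for every class that contains the priors near the point mass
at zero. -/
theorem exists_pos_le_minimaxTotRegret {k : ℕ} (hk : 1 ≤ k) (G : Set (Measure ℝ)) {R₀ ε₀ : ℝ}
    (hR₀ : 0 < R₀) (hε₀ : 0 < ε₀)
    (hG : ∀ R : ℝ, R ≤ R₀ → ∀ π : Measure ℝ, IsProbabilityMeasure π → π (Set.Icc (-R) R) = 1 →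
      π {0}ᶜ ≤ ENNReal.ofReal ε₀ → π ∈ G) {N : ℕ} (hN : 1 ≤ N) :
    ∃ c : ℝ, 0 < c ∧ (c : EReal) ≤
      EmpiricalBayes.minimaxTotRegret normalMeans (fun θ => θ ^ k) N G := by
  obtain ⟨n, rfl⟩ : ∃ n, N = n + 1 := ⟨N - 1, by omega⟩
  have hk1 : (1 : ℝ) ≤ k := by exact_mod_cast hk
  set R : ℝ := min R₀ (1 / 2 ^ 10) with hRdef
  have hR : 0 < R := lt_min hR₀ (by positivity)
  have hR2 : R ^ 2 ≤ (k : ℝ) / 2 ^ 20 := by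
    calc R ^ 2 ≤ (1 / 2 ^ 10 : ℝ) ^ 2 := by gcongr; exact min_le_right _ _
      _ ≤ (k : ℝ) / 2 ^ 20 := by
        rw [div_pow, ← pow_mul, one_pow]
        gcongr
  set S : ℝ := ∑ d ∈ Finset.range (3 * k + 1), √(d.factorial) / R ^ d with hSdef
  have hS : ∀ d ≤ 3 * k, √(d.factorial) / R ^ d ≤ S := fun d hd =>
    Finset.single_le_sum (f := fun d : ℕ => √(d.factorial : ℝ) / R ^ d)
      (fun d _ => by positivity) (Finset.mem_range.2 (by omega))
  set E : ℝ := (6 * k + 1) * (k * (S * 16 ^ (6 * k))) with hE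
  have hlim : ∀ c b : ℝ, 0 < b → ∀ p : ℕ, p ≠ 0 → ∀ᶠ δ : ℝ in 𝓝[>] 0, c * δ ^ p ≤ b := by
    intro c b hb p hp
    have h1 : Tendsto (fun δ : ℝ => c * δ ^ p) (𝓝 0) (𝓝 0) :=
      Continuous.tendsto' (by fun_prop) _ _ (by simp [hp])
    exact (h1.mono_left nhdsWithin_le_nhds).eventually_le_const hb
  -- With m = k and R fixed and ε = δ E, every constraint holds for small δ; the linearisation error
  -- is of order δ⁴ against δ².
  obtain ⟨δ, hδ0, h1, h2, h3, h4⟩ := (eventually_mem_nhdsWithin.and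
    ((hlim E (1 / 4) (by norm_num) 1 one_ne_zero).and
    ((hlim (2 * E) ε₀ hε₀ 1 one_ne_zero).and
    ((hlim n (1 / 40) (by norm_num) 2 two_ne_zero).and
    (hlim (4096 * E ^ 4 * R ^ (2 * k) * Real.exp (8 * R ^ 2)) 1 one_pos 2
      two_ne_zero))))).exists
  have hδ : 0 < δ := hδ0
  rw [pow_one] at h1 h2
  refine ⟨_, ?_, le_minimaxTotRegret_of_parameters (δ := δ) (ε := δ * E) (S := S) hk le_rfl n
    hR hδ hR2 hS (le_of_eq (by rw [hE]; ring)) (by linarith) ?_ h3 G fun π p1 p2 p3 =>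
      hG R (min_le_left _ _) π p1 p2 (p3.trans (ENNReal.ofReal_le_ofReal (by linarith)))⟩
  · positivity
  · calc 4096 * (δ * E) ^ 4 * R ^ (2 * k) * Real.exp (8 * R ^ 2)
        = δ ^ 2 * ((4096 * E ^ 4 * R ^ (2 * k) * Real.exp (8 * R ^ 2)) * δ ^ 2) := by ring
      _ ≤ δ ^ 2 * 1 := by gcongr
      _ = δ ^ 2 := mul_one _

theorem exists_pos_forall_lt_le {f : ℕ → ℝ} (hf : ∀ n, 0 < f n) (N : ℕ) :
    ∃ c : ℝ, 0 < c ∧ ∀ n < N, c ≤ f n := by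
  induction N with
  | zero => exact ⟨1, one_pos, fun n hn => absurd hn (Nat.not_lt_zero n)⟩
  | succ N ih =>
    obtain ⟨c, hc, h⟩ := ih
    refine ⟨min c (f N), lt_min hc (hf N), fun n hn => ?_⟩
    rcases Nat.lt_succ_iff_lt_or_eq.1 hn with hn | rfl
    · exact (min_le_left _ _).trans (h n hn)
    · exact min_le_right _ _

/-- A rate that holds eventually holds from any point on after which the values are positive. -/
theorem exists_rate_of_eventually {F : ℕ → EReal} {g : ℕ → ℝ} {n₀ : ℕ}
    (hg : ∀ n, n₀ ≤ n → 0 ≤ g n) (hpos : ∀ n, n₀ ≤ n → ∃ c : ℝ, 0 < c ∧ (c : EReal) ≤ F n)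
    {c : ℝ} (hc : 0 < c) (hev : ∀ᶠ n in atTop, ((c * g n : ℝ) : EReal) ≤ F n) :
    ∃ c : ℝ, 0 < c ∧ ∀ n, n₀ ≤ n → ((c * g n : ℝ) : EReal) ≤ F n := by
  obtain ⟨N, hN⟩ := eventually_atTop.1 hev
  have hpos' : ∀ n, ∃ c : ℝ, 0 < c ∧ (n₀ ≤ n → ((c * g n : ℝ) : EReal) ≤ F n) := by
    intro n
    by_cases hn : n₀ ≤ n
    · obtain ⟨c, hc, h⟩ := hpos n hn
      have hgn := hg n hn
      refine ⟨c / (g n + 1), by positivity, fun _ => le_trans ?_ h⟩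
      refine EReal.coe_le_coe_iff.2 ?_
      rw [div_mul_eq_mul_div, div_le_iff₀ (by positivity)]
      nlinarith
    · exact ⟨1, one_pos, fun h => absurd h hn⟩
  choose f hf0 hf using hpos'
  obtain ⟨c', hc', h⟩ := exists_pos_forall_lt_le hf0 N
  refine ⟨min c c', lt_min hc hc', fun n hn => ?_⟩
  have hgn := hg n hn
  rcases lt_or_ge n N with hnN | hnN
  · refine le_trans (EReal.coe_le_coe_iff.2 ?_) (hf n hn)
    exact mul_le_mul_of_nonneg_right ((min_le_right _ _).trans (h n hnN)) hgn
  · refine le_trans (EReal.coe_le_coe_iff.2 ?_) (hN n hnN)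
    exact mul_le_mul_of_nonneg_right (min_le_left _ _) hgn

theorem half_le_natFloor {x : ℝ} (hx : 1 ≤ x) : x / 2 ≤ (⌊x⌋₊ : ℝ) := by
  have h1 := Nat.lt_floor_add_one x
  have h2 : (1 : ℝ) ≤ (⌊x⌋₊ : ℝ) := by exact_mod_cast Nat.one_le_floor_iff x |>.2 hx
  linarith

theorem tendsto_log_natCast_atTop : Tendsto (fun n : ℕ => Real.log n) atTop atTop :=
  Real.tendsto_log_atTop.comp tendsto_natCast_atTop_atTop

theorem tendsto_div_log_atTop : Tendsto (fun y : ℝ => y / Real.log y) atTop atTop := by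
  have h : Tendsto (fun y : ℝ => Real.log y / y) atTop (𝓝[>] 0) := by
    refine tendsto_nhdsWithin_iff.2 ⟨?_, ?_⟩
    · simpa using Real.isLittleO_log_id_atTop.tendsto_div_nhds_zero
    · filter_upwards [eventually_gt_atTop 1] with y hy
      exact div_pos (Real.log_pos hy) (by linarith)
  refine (tendsto_inv_nhdsGT_zero.comp h).congr fun y => ?_
  simp [Function.comp]

/-- Here R stays fixed and σ = 3m log(3m / R), so the constraint on n reads m log m ≲ log n; this is
the source of log log n. In A, 117 is 109 + 8, and the further 12 pays for 4 · 3 m log m. -/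
theorem eventually_boundedPriors_rate {k : ℕ} (hk : 1 ≤ k) {h : ℝ} (hh : 0 < h) :
    ∃ c : ℝ, 0 < c ∧ ∀ᶠ n : ℕ in atTop,
      ((c * (Real.log n / Real.log (Real.log n)) ^ (k + 1) : ℝ) : EReal) ≤
        EmpiricalBayes.minimaxTotRegret normalMeans (fun θ => θ ^ k) n
          (EmpiricalBayes.boundedPriors h) := by
  set R : ℝ := min h 1 with hRdef
  have hR : 0 < R := lt_min hh one_pos
  have hR1 : R ≤ 1 := min_le_right _ _
  have hlogR : 0 ≤ Real.log (3 / R) := Real.log_nonneg (by rw [le_div_iff₀ hR]; linarith)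
  set A : ℝ := 117 + k + 12 * Real.log (3 / R) with hA
  have hA0 : 0 < A := by positivity
  set c : ℝ := 1 / (A + 12) with hc
  have hc0 : 0 < c := by positivity
  have hc1 : c ≤ 1 := by
    rw [hc, div_le_one (by positivity)]
    have : (0 : ℝ) ≤ k := Nat.cast_nonneg k
    linarith
  refine ⟨3 / 1280 * (c / 2) ^ (k + 1), by positivity, ?_⟩
  have hlim : Tendsto (fun n : ℕ => c * (Real.log n / Real.log (Real.log n))) atTop atTop :=
    (tendsto_div_log_atTop.comp tendsto_log_natCast_atTop).const_mul_atTop hc0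
  filter_upwards [hlim.eventually_ge_atTop ((k : ℝ) + 2 ^ 20), eventually_ge_atTop 1,
    tendsto_log_natCast_atTop.eventually_ge_atTop 1,
    (Real.tendsto_log_atTop.comp tendsto_log_natCast_atTop).eventually_ge_atTop 1]
    with n hn1 hnN hy1 hly1
  set y := Real.log n with hy
  have hly : 1 ≤ Real.log y := hly1
  set z := c * (y / Real.log y) with hz
  have hz1 : 1 ≤ z := by
    have : (0 : ℝ) ≤ k := Nat.cast_nonneg k
    linarith
  set m := ⌊z⌋₊ with hm
  have hmz : (m : ℝ) ≤ z := Nat.floor_le (by linarith)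
  have hkm : k ≤ m := Nat.le_floor (by linarith)
  have hm20 : (2 : ℝ) ^ 20 ≤ m := by
    have : 2 ^ 20 ≤ m := Nat.le_floor (by push_cast; linarith [(Nat.cast_nonneg k : (0 : ℝ) ≤ k)])
    exact_mod_cast this
  have hm1 : (1 : ℝ) ≤ m := le_trans (by norm_num) hm20
  have hmy : (m : ℝ) ≤ y := by
    refine hmz.trans ?_
    calc z ≤ 1 * (y / 1) := by rw [hz]; gcongr
      _ = y := by ring
  have hlogm : Real.log m ≤ Real.log y := Real.log_le_log (by linarith) hmy
  have hB : 1 ≤ 3 * m / R := by rw [le_div_iff₀ hR]; linarith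
  have hmain := le_minimaxTotRegret_of_log hk hkm hnN (R := R)
    (σ := 3 * m * Real.log (3 * m / R)) hR (by
      rw [le_div_iff₀ (by positivity)]
      nlinarith) (fun d hd => sqrt_factorial_div_pow_le hR hB (by
        rw [mul_div_cancel₀ _ hR.ne']
        refine Real.sqrt_le_iff.2 ⟨by positivity, ?_⟩
        nlinarith) hd) (by
      have e : Real.log (3 * m / R) = Real.log (3 / R) + Real.log m := by
        rw [← Real.log_mul (by positivity) (by positivity)]
        congr 1; ring
      rw [e, ← hy]
      have h1 : (8 + k) * R ^ 2 ≤ (8 + k) * m := by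
        gcongr
        nlinarith
      have h2 : 109 * m + (8 + k) * R ^ 2 +
          4 * (3 * m * (Real.log (3 / R) + Real.log m)) ≤ (A + 12) * (m * Real.log y) := by
        have h3 : (m : ℝ) * Real.log m ≤ m * Real.log y := by gcongr
        have h4 : A * m ≤ A * (m * Real.log y) := by
          gcongr
          exact le_mul_of_one_le_right (by positivity) hly
        rw [hA] at h4 ⊢
        linarith
      refine h2.trans ?_
      have h5 : (m : ℝ) * Real.log y ≤ c * y := by
        calc (m : ℝ) * Real.log y ≤ z * Real.log y := by gcongr
          _ = c * y := by rw [hz]; field_simp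
      calc (A + 12) * (m * Real.log y) ≤ (A + 12) * (c * y) := by gcongr
        _ = y := by rw [hc]; field_simp) (EmpiricalBayes.boundedPriors h) (fun π h1 h2 _ => by
      refine ⟨h1, le_antisymm prob_le_one (h2.symm.le.trans (measure_mono ?_))⟩
      exact Set.Icc_subset_Icc (neg_le_neg (min_le_left _ _)) (min_le_left _ _))
  refine le_trans (EReal.coe_le_coe_iff.2 ?_) hmain
  calc 3 / 1280 * (c / 2) ^ (k + 1) * (y / Real.log y) ^ (k + 1)
      = 3 / 1280 * (z / 2) ^ (k + 1) := by rw [hz, mul_assoc, ← mul_pow]; congr 2; ring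
    _ ≤ _ := by
      gcongr
      exact half_le_natFloor hz1

/-- For t ≤ R the tail event misses zero and the bound at R is smaller than the bound at t; for t >
R the event is null. -/
theorem mem_SubG_of_concentrated {s R : ℝ} (hs : 0 < s) {π : Measure ℝ}
    (hπ : IsProbabilityMeasure π) (hR : π (Set.Icc (-R) R) = 1)
    (h0 : π {0}ᶜ ≤ ENNReal.ofReal (2 * Real.exp (-R ^ 2 / (2 * s)))) :
    π ∈ EmpiricalBayes.SubG s := by
  refine ⟨hπ, fun t ht => ?_⟩
  rcases le_or_gt t R with htR | htR
  · have h1 : π.real {θ | t ≤ |θ|} ≤ 2 * Real.exp (-R ^ 2 / (2 * s)) := by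
      refine ENNReal.toReal_le_of_le_ofReal (by positivity) (le_trans (measure_mono ?_) h0)
      intro θ hθ h
      replace hθ : t ≤ |θ| := hθ
      rw [Set.mem_singleton_iff] at h
      rw [h, abs_zero] at hθ
      linarith
    refine h1.trans ?_
    gcongr
  · have h1 : π (Set.Icc (-R) R)ᶜ = 0 := (prob_compl_eq_zero_iff measurableSet_Icc).2 hR
    have hsub : {θ : ℝ | t ≤ |θ|} ⊆ (Set.Icc (-R) R)ᶜ := fun θ hθ h => by
      have h2 : |θ| ≤ R := abs_le.2 h
      replace hθ : t ≤ |θ| := hθ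
      linarith
    have h2 : π {θ | t ≤ |θ|} = 0 := measure_mono_null hsub h1
    rw [measureReal_def, h2]
    simp only [ENNReal.toReal_zero]
    positivity

/-- With R² = m / 2^20, √(d!) / R^d is only exponential in m, so m may be proportional to log n. The
term 1/s in A makes the mass away from zero at most 2 exp(-R² / (2s)). -/
theorem eventually_SubG_rate {k : ℕ} (hk : 1 ≤ k) {s : ℝ} (hs : 0 < s) :
    ∃ c : ℝ, 0 < c ∧ ∀ᶠ n : ℕ in atTop,
      ((c * (Real.log n) ^ (k + 1) : ℝ) : EReal) ≤
        EmpiricalBayes.minimaxTotRegret normalMeans (fun θ => θ ^ k) n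
          (EmpiricalBayes.SubG s) := by
  set Λ : ℝ := Real.log (3 * 2 ^ 20) with hΛ
  have hΛ0 : 0 ≤ Λ := Real.log_nonneg (by norm_num)
  set A : ℝ := 117 + k + 12 * Λ + 1 / s with hA
  have hA0 : 0 < A := by positivity
  set c : ℝ := 1 / A with hc
  have hc0 : 0 < c := by positivity
  refine ⟨3 / 1280 * (c / 2) ^ (k + 1), by positivity, ?_⟩
  have hlim : Tendsto (fun n : ℕ => c * Real.log n) atTop atTop :=
    tendsto_log_natCast_atTop.const_mul_atTop hc0
  filter_upwards [hlim.eventually_ge_atTop (k : ℝ), eventually_ge_atTop 1] with n hn1 hnN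
  set z := c * Real.log n with hz
  have hz1 : 1 ≤ z := le_trans (by exact_mod_cast hk) hn1
  set m := ⌊z⌋₊ with hm
  have hmz : (m : ℝ) ≤ z := Nat.floor_le (by linarith)
  have hkm : k ≤ m := Nat.le_floor hn1
  have hm1 : (1 : ℝ) ≤ m := by exact_mod_cast hk.trans hkm
  have hAm : A * m ≤ Real.log n := by
    calc A * m ≤ A * z := by gcongr
      _ = Real.log n := by rw [hz, hc]; field_simp
  set R : ℝ := √(m / 2 ^ 20) with hRdef
  have hR2 : R ^ 2 = m / 2 ^ 20 := Real.sq_sqrt (by positivity)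
  have hR : 0 < R := Real.sqrt_pos.2 (by positivity)
  have hkR : (8 + k) * R ^ 2 ≤ (8 + k) * m := by
    gcongr
    rw [hR2]
    exact div_le_self (by positivity) (by norm_num)
  have hsm : 0 ≤ 1 / s * m := by positivity
  have hkm0 : (0 : ℝ) ≤ k * m := by positivity
  have hΛm : 0 ≤ Λ * m := by positivity
  have hmain := le_minimaxTotRegret_of_log hk hkm hnN (R := R) (σ := 3 * m * Λ) hR hR2.le
    (fun d hd => sqrt_factorial_div_pow_le hR (by norm_num) (by
      refine Real.sqrt_le_iff.2 ⟨by positivity, ?_⟩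
      rw [mul_pow, hR2]
      linarith) hd) (by
      rw [hA] at hAm
      linarith) (EmpiricalBayes.SubG s) (fun π h1 h2 h3 => by
      refine mem_SubG_of_concentrated hs h1 h2 (h3.trans (ENNReal.ofReal_le_ofReal ?_))
      gcongr
      have e : -R ^ 2 / (2 * s) = -(1 / s * m) / 2 ^ 21 := by
        rw [hR2]; field_simp
      rw [e]
      rw [hA] at hAm
      linarith)
  refine le_trans (EReal.coe_le_coe_iff.2 ?_) hmain
  calc 3 / 1280 * (c / 2) ^ (k + 1) * Real.log n ^ (k + 1)
      = 3 / 1280 * (z / 2) ^ (k + 1) := by rw [hz, mul_assoc, ← mul_pow]; congr 2; ring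
    _ ≤ _ := by
      gcongr
      exact half_le_natFloor hz1

end Rates

theorem mainTheorem2 (k : ℕ) (hk : 1 ≤ k) :
    (∃ n₀ : ℕ, ∀ h : ℝ, 0 < h → ∃ c : ℝ, 0 < c ∧ ∀ n : ℕ, n₀ ≤ n →
      ((c * (Real.log n / Real.log (Real.log n)) ^ (k + 1) : ℝ) : EReal) ≤
        EmpiricalBayes.minimaxTotRegret normalMeans (fun θ => θ ^ k) n
          (EmpiricalBayes.boundedPriors h)) ∧
    (∃ n₀ : ℕ, ∀ s : ℝ, 0 < s → ∃ c : ℝ, 0 < c ∧ ∀ n : ℕ, n₀ ≤ n →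
      ((c * (Real.log n) ^ (k + 1) : ℝ) : EReal) ≤
        EmpiricalBayes.minimaxTotRegret normalMeans (fun θ => θ ^ k) n
          (EmpiricalBayes.SubG s)) := by
  have hlog : ∀ n : ℕ, 3 ≤ n → 1 ≤ Real.log n := by
    intro n hn
    rw [Real.le_log_iff_exp_le (by positivity)]
    have : (3 : ℝ) ≤ n := by exact_mod_cast hn
    linarith [Real.exp_one_lt_three]
  -- From n = 3 on, log n ≥ 1 and both rates are nonnegative. The threshold of the asymptotic bound
  -- depends on h or s; the finitely many n before it only shrink the constant, by positivity of the
  -- minimax regret.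
  refine ⟨⟨3, fun h hh => ?_⟩, ⟨3, fun s hs => ?_⟩⟩
  · obtain ⟨c, hc, hev⟩ := eventually_boundedPriors_rate hk hh
    refine exists_rate_of_eventually (fun n hn => ?_) (fun n hn => ?_) hc hev
    · have h1 := hlog n hn
      have h2 := Real.log_nonneg h1
      positivity
    · refine exists_pos_le_minimaxTotRegret hk _ hh one_pos (fun R hR π h1 h2 _ => ?_)
        (by omega)
      exact ⟨h1, le_antisymm prob_le_one (h2.symm.le.trans
        (measure_mono (Set.Icc_subset_Icc (neg_le_neg hR) hR)))⟩
  · obtain ⟨c, hc, hev⟩ := eventually_SubG_rate hk hs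
    refine exists_rate_of_eventually (fun n hn => ?_) (fun n hn => ?_) hc hev
    · have h1 := hlog n hn
      positivity
    · refine exists_pos_le_minimaxTotRegret hk _ one_pos
        (ε₀ := 2 * Real.exp (-1 ^ 2 / (2 * s))) (by positivity) (fun R hR π h1 h2 h3 => ?_)
        (by omega)
      refine mem_SubG_of_concentrated hs h1 (R := 1) ?_ h3
      exact le_antisymm prob_le_one (h2.symm.le.trans
        (measure_mono (Set.Icc_subset_Icc (neg_le_neg hR) hR)))
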